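/- Let $V$ be a countably infinite set. A frog configuration $(n,s)$ consists of numbers $n(x)\in\mathbb N_0$, $x\in V$ (the number of initial frogs at $x$), and paths $(s_j(x,i))_{j\ge 0}$ in $V$ with $s_0(x,i)=x$, for $x\in V$, $i\ge 1$. For $v\in V$ put $W_0^v=\{v\}$ and, for $j\ge 1$, let $W_j^v$ be the set of all $x\in V\setminus\bigcup_{k<j}W_k^v$ for which there are $k<j$, $y\in W_k^v$ and $1\le i\le n(y)$ with $s_{j-k}(y,i)=x$; let $W^v=\bigcup_{j\ge 0}W_j^v$. The site $v$ is recurrent for $(n,s)$ if there are infinitely many $x\in W^v$ such that $s_j(x,i)=v$ for some $1\le i\le n(x)$ and $j\ge 0$. Let $K$ be an irreducible stochastic matrix on $V$ and let $\Phi$ be a subgroup of the group of permutations of $V$ such that $K(\varphi(u),\varphi(v))=K(u,v)$ for all $\varphi\in\Phi$ and $u,v\in V$. Suppose that all orbits $[x]=\{\varphi(x):\varphi\in\Phi\}$, $x\in V$, are infinite. On a probability space $(\Omega,\mathcal F,P)$ let $\eta(x)$, $x\in V$, be $\mathbb N_0$-valued random variables such that $\eta(x)$ and $\eta(y)$ have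 the same distribution whenever $[x]=[y]$, and let $S(x,i)=(S_j(x,i))_{j\ge 0}$, $x\in V$, $i\ge 1$, be Markov chains with transition matrix $K$ and $S_0(x,i)=x$. Assume that all the $\eta(x)$ and all the paths $S(x,i)$, $x\in V$, $i\ge 1$, are independent. Let $R_v$ be the event that $v$ is recurrent for $(\eta,S)$. Let $\mathcal C(v)$ be the set of all $y\in V$ such that $y$ can be reached from $v$ and $v$ from $y$ along finite paths whose steps have positive $K$-probability (so $\mathcal C(v)=V$ by irreducibility). If the factor chain on the set of orbits, whose transition matrix is $\tilde K([x],[y])=\sum_{z\in[y]}K(x,z)$, has an invariant probability measure, then the zero-one law for recurrence and transience holds: either $P[R_v]=0$ for all $v\in V$, or $P[R_v]=P[\eta(v)\ge 1,\ \#\mathcal C(v)=\infty]$ for all $v\in V$. If there are only finitely many orbits (the quasi-transitive case), then $\tilde K$ has an invariant probability measure, and hence the zero-one law holds. -/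

import Mathlib

open MeasureTheory ProbabilityTheory

noncomputable section

namespace Frog

/-- The state `y` can be reached from `x` along a finite (possibly empty) path all of whose
steps `a → b` satisfy `0 < κ a b`. -/
def CanReach {V : Type*} (κ : V → V → ℝ) (x y : V) : Prop :=
  Relation.ReflTransGen (fun a b => 0 < κ a b) x y

/-- The cluster of `v`: all `y` such that `y` can be reached from `v` and `v` from `y`. -/
def cluster {V : Type*} (κ : V → V → ℝ) (v : V) : Set V :=
  {y | CanReach κ v y ∧ CanReach κ y v}

/-- `K` is a stochastic matrix on `V`. -/
def IsStochastic {V : Type*} (K : V → V → ℝ) : Prop :=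
  (∀ x y, 0 ≤ K x y) ∧ ∀ x, HasSum (K x) 1

/-- `K` is irreducible. -/
def IsIrreducible {V : Type*} (K : V → V → ℝ) : Prop :=
  ∀ x y, CanReach K x y

/-- The matrix `K` is invariant under every permutation in `Φ`. -/
def IsInvariantUnder {V : Type*} (Φ : Subgroup (Equiv.Perm V)) (K : V → V → ℝ) : Prop :=
  ∀ φ ∈ Φ, ∀ u v, K (φ u) (φ v) = K u v

/-- The space of orbits of `Φ` on `V`. -/
abbrev Orbits {V : Type*} (Φ : Subgroup (Equiv.Perm V)) : Type _ :=
  MulAction.orbitRel.Quotient Φ V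

/-- The sum of `K x z` over `z` in a fixed orbit depends only on the orbit of `x`. -/
theorem tsum_orbit_eq {V : Type*} (Φ : Subgroup (Equiv.Perm V)) (K : V → V → ℝ)
    (hK : IsInvariantUnder Φ K) (b : Orbits Φ) (x y : V)
    (hxy : MulAction.orbitRel Φ V x y) :
    (∑' z : b.orbit, K x z) = ∑' z : b.orbit, K y z := by
  obtain ⟨g, rfl⟩ := hxy
  have hmem : ∀ z : V, z ∈ b.orbit ↔ (g : Equiv.Perm V) z ∈ b.orbit := by
    intro z
    rw [MulAction.orbitRel.Quotient.mem_orbit, MulAction.orbitRel.Quotient.mem_orbit]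
    have : (Quotient.mk'' ((g : Equiv.Perm V) z) : Orbits Φ) = Quotient.mk'' z :=
      Quotient.sound' ⟨g, rfl⟩
    rw [this]
  rw [← Equiv.tsum_eq ((g : Equiv.Perm V).subtypeEquiv hmem)]
  refine tsum_congr fun z => ?_
  exact hK g g.2 y z

/-- The transition matrix of the factor chain on orbits: the entry at `([x], b)` is the sum of
`K x z` over `z` in the orbit `b`. -/
def factorMatrix {V : Type*} (Φ : Subgroup (Equiv.Perm V)) (K : V → V → ℝ)
    (hK : IsInvariantUnder Φ K) (a b : Orbits Φ) : ℝ :=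
  Quotient.liftOn' a (fun x => ∑' z : b.orbit, K x z) (tsum_orbit_eq Φ K hK b)

/-- `μ` is (the mass function of) an invariant probability measure of the matrix `M` on the
discrete space `A`. -/
def IsInvariantProbability {A : Type*} (M : A → A → ℝ) (μ : A → ℝ) : Prop :=
  (∀ a, 0 ≤ μ a) ∧ HasSum μ 1 ∧ ∀ b, HasSum (fun a => μ a * M a b) (μ b)

/-- Under `P`, the process `X` is a (time-homogeneous) Markov chain with transition matrix `K`:
given `X 0 = a 0, …, X n = a n`, the next state is `y` with probability `K (a n) y`. -/
def IsMarkovChain {V Ω : Type*} [MeasurableSpace V] [MeasurableSpace Ω] (P : Measure Ω)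
    (K : V → V → ℝ) (X : ℕ → Ω → V) : Prop :=
  (∀ j, Measurable (X j)) ∧
    ∀ (n : ℕ) (a : ℕ → V) (y : V),
      P {ω | (∀ k ≤ n, X k ω = a k) ∧ X (n + 1) ω = y} =
        P {ω | ∀ k ≤ n, X k ω = a k} * ENNReal.ofReal (K (a n) y)

/- A frog configuration consists of `n : V → ℕ` and `s : V → ℕ → ℕ → V`, where `n x` is the number
of initial frogs at `x` and `s x i j` is the position after `j` steps of the frog with index `i`
originating at `x`. Frogs are indexed from `0`, so the initial frogs at `x` are those with
`i < n x`. -/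

/-- The set of sites visited for the first time at time `j` by an active frog, when the initial
frogs at `v` are woken up at time `0`. -/
def wakeSet {V : Type*} (n : V → ℕ) (s : V → ℕ → ℕ → V) (v : V) : ℕ → Set V
  | 0 => {v}
  | j + 1 => {x | (∀ k : Fin (j + 1), x ∉ wakeSet n s v k) ∧
      ∃ k : Fin (j + 1), ∃ y ∈ wakeSet n s v k, ∃ i < n y, s y i (j + 1 - k) = x}

/-- The set of all sites ever visited by an active frog. -/
def wokenSites {V : Type*} (n : V → ℕ) (s : V → ℕ → ℕ → V) (v : V) : Set V :=
  ⋃ j, wakeSet n s v j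

/-- The site `v` is recurrent for `(n, s)`: it is visited by initial frogs originating at
infinitely many distinct woken sites. -/
def IsRecurrentSite {V : Type*} (n : V → ℕ) (s : V → ℕ → ℕ → V) (v : V) : Prop :=
  {x ∈ wokenSites n s v | ∃ i < n x, ∃ j, s x i j = v}.Infinite

/-- The event that `v` is recurrent for the random configuration `(η, S)`. -/
def recurrenceEvent {V Ω : Type*} (η : V → Ω → ℕ) (S : V → ℕ → ℕ → Ω → V) (v : V) : Set Ω :=
  {ω | IsRecurrentSite (fun x => η x ω) (fun x i j => S x i j ω) v}

/-- The zero-one law for recurrence and transience of the frog process `(η, S)` with ellipticity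
variables `κ`. -/
def ZeroOneLaw {V Ω : Type*} [MeasurableSpace Ω] (P : Measure Ω) (κ : Ω → V → V → ℝ)
    (η : V → Ω → ℕ) (S : V → ℕ → ℕ → Ω → V) : Prop :=
  (∀ v, P (recurrenceEvent η S v) = 0) ∨
    ∀ v, P (recurrenceEvent η S v) = P {ω | 1 ≤ η v ω ∧ (cluster (κ ω) v).Infinite}

/-- All the random variables `η x` and all the paths `(S x i j)_j`, for `x` in `V` and all frog
indices `i`, are mutually independent under `P`. -/
def IndependentIngredients {V Ω : Type*} [MeasurableSpace V] [MeasurableSpace Ω] (P : Measure Ω)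
    (η : V → Ω → ℕ) (S : V → ℕ → ℕ → Ω → V) : Prop :=
  iIndep (fun q : V ⊕ (V × ℕ) =>
    Sum.elim (fun x => MeasurableSpace.comap (η x) inferInstance)
      (fun p => MeasurableSpace.comap (fun ω j => S p.1 p.2 j ω)
        (inferInstance : MeasurableSpace (ℕ → V))) q) P

end Frog

end

namespace Frog

/-! Write `VisitedInf ω v w` if, after waking `v`, frogs from infinitely many woken sites visit `w`;
recurrence of `v` is `VisitedInf ω v v`. The configuration is a family of independent sites, and the
recurrent vertices form a random set D(ω).

Three facts carry the proof. (1) Almost surely, `VisitedInf ω v w` for one `w` implies it for every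
`w` (`ae_visitedInf_of_visitedInf`): from each site that sends a frog to `w`, the first such frog
steps to `y` right after its first visit with probability `K w y`, and a Borel-Cantelli lemma along
the exploration (`ae_infinite_of_infinite`) yields infinitely many visits to `y`. (2) The event that
D(ω) is non-empty is trivial (`exists_visitedInf_zero_one`): it is `Φ`-invariant, and infinite
orbits allow every finite set to be moved off itself, so the action is mixing enough. (3) If D(ω) is
non-empty, a `K`-chain independent of ω hits it almost surely from every start
(`ae_hitProb_eq_one`): the hitting probability is superharmonic, its mean is constant on orbits, the
invariant probability of the factor chain forces equality in the mean and hence almost surely, and a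
harmonic function bounded by 1 that attains 1 is identically 1.

For the conclusion (`ae_visitedInf_of_count_pos`), suppose some vertex is recurrent with positive
probability, so D is almost surely non-empty. Let `u` carry a frog and be non-recurrent, and remove
all frogs at `u`. By (1), no recurrent vertex is lost by the removal. The first frog at `u` is
independent of the modified configuration, so by (3) it hits a vertex that is recurrent there. That
vertex is woken from `u`, and (1) makes `u` recurrent, a contradiction. Conversely, a vertex without
frogs wakes only itself. -/

/-- The randomness attached to one site: the first component of entry `0` is the number of frogs,
the second component of entry `i + 1` is the path of the frog with index `i`. -/
abbrev Site (V : Type*) := ℕ → ℕ × (ℕ → V)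

/-! ### Waking as reachability, and the effect of changing one site -/

section Deterministic

variable {V : Type*}

/-- A frog originating at a site with data `a` visits `x`. -/
def Sends (a : Site V) (x : V) : Prop := ∃ i < (a 0).1, ∃ j, (a (i + 1)).2 j = x

/-- The sites woken up when the frogs at `v` start moving. -/
def woken (ω : V → Site V) (v : V) : Set V :=
  {x | Relation.ReflTransGen (fun y z => Sends (ω y) z) v x}

/-- Frogs from infinitely many sites of `woken ω v` visit `w`. -/
def VisitedInf (ω : V → Site V) (v w : V) : Prop := {x ∈ woken ω v | Sends (ω x) w}.Infinite

theorem self_mem_woken (ω : V → Site V) (v : V) : v ∈ woken ω v := Relation.ReflTransGen.refl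

theorem woken_tail {ω : V → Site V} {v x y : V} (h : x ∈ woken ω v) (hs : Sends (ω x) y) :
    y ∈ woken ω v := Relation.ReflTransGen.tail h hs

theorem woken_subset_of_mem {ω : V → Site V} {v x : V} (h : x ∈ woken ω v) :
    woken ω x ⊆ woken ω v := fun _ hy => Relation.ReflTransGen.trans h hy

theorem woken_subset_of_eqOn {ω ω' : V → Site V} {v : V}
    (h : ∀ x ∈ woken ω v, ω' x = ω x) : woken ω v ⊆ woken ω' v := by
  intro x hx
  induction hx with
  | refl => exact self_mem_woken _ _
  | tail hy hs ih =>
    refine woken_tail ih ?_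
    rw [h _ hy]
    exact hs

theorem woken_eq_of_eqOn {ω ω' : V → Site V} {v : V}
    (h : ∀ x ∈ woken ω v, ω' x = ω x) : woken ω' v = woken ω v := by
  refine Set.Subset.antisymm ?_ (woken_subset_of_eqOn h)
  intro x hx
  induction hx with
  | refl => exact self_mem_woken _ _
  | tail hy hs ih =>
    refine woken_tail ih ?_
    rw [← h _ ih]
    exact hs

theorem not_sends_of_count_eq_zero {a : Site V} (ha : (a 0).1 = 0) (x : V) : ¬ Sends a x := by
  rintro ⟨i, hi, -⟩
  omega

section Update

variable [DecidableEq V] {ω : V → Site V} {u : V} {a : Site V}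

theorem sends_of_sends_update (ha : (a 0).1 = 0) {y z : V}
    (h : Sends (Function.update ω u a y) z) : Sends (ω y) z := by
  by_cases hy : y = u
  · subst hy
    rw [Function.update_self] at h
    exact absurd h (not_sends_of_count_eq_zero ha z)
  · rwa [Function.update_of_ne hy] at h

theorem woken_update_subset (ha : (a 0).1 = 0) (x : V) :
    woken (Function.update ω u a) x ⊆ woken ω x := by
  intro y hy
  induction hy with
  | refl => exact self_mem_woken _ _
  | tail hy hs ih => exact woken_tail ih (sends_of_sends_update ha hs)

theorem VisitedInf.of_update (ha : (a 0).1 = 0) {x w : V}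
    (h : VisitedInf (Function.update ω u a) x w) : VisitedInf ω x w :=
  h.mono fun _ hy => ⟨woken_update_subset ha x hy.1, sends_of_sends_update ha hy.2⟩

/-- A chain of wake-ups starting at `x` either never uses the frogs at `u`, and then survives the
change, or runs inside `woken ω u` once it has used them. -/
theorem woken_subset_union (x : V) :
    woken ω x ⊆ woken (Function.update ω u a) x ∪ woken ω u := by
  intro y hy
  induction hy with
  | refl => exact Or.inl (self_mem_woken _ _)
  | @tail b c hy hs ih =>
    rcases ih with ih | ih
    · by_cases hb : b = u
      · subst hb
        exact Or.inr (woken_tail (self_mem_woken _ _) hs)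
      · refine Or.inl (woken_tail ih ?_)
        rwa [Function.update_of_ne hb]
    · exact Or.inr (woken_tail ih hs)

/-- An infinite set covered by two sets and `{u}` has an infinite part in one of the two; `u` is set
aside because its own frogs have changed. -/
theorem VisitedInf.update_or {x w : V} (h : VisitedInf ω x w) :
    VisitedInf (Function.update ω u a) x w ∨ VisitedInf ω u w := by
  by_contra hcon
  simp only [VisitedInf, not_or, Set.not_infinite] at hcon
  refine h (((hcon.1.union hcon.2).union (Set.finite_singleton u)).subset ?_)
  rintro y ⟨hy, hs⟩
  by_cases hyu : y = u
  · exact Or.inr hyu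
  · rcases woken_subset_union (u := u) (a := a) x hy with h' | h'
    · refine Or.inl (Or.inl ⟨h', ?_⟩)
      rwa [Function.update_of_ne hyu]
    · exact Or.inl (Or.inr ⟨h', hs⟩)

end Update

theorem VisitedInf.of_mem_woken {ω : V → Site V} {v x w : V} (hx : x ∈ woken ω v)
    (h : VisitedInf ω x w) : VisitedInf ω v w :=
  h.mono fun _ hy => ⟨woken_subset_of_mem hx hy.1, hy.2⟩

theorem VisitedInf.count_pos {ω : V → Site V} {v w : V} (h : VisitedInf ω v w) :
    1 ≤ (ω v 0).1 := by
  by_contra hcon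
  have h0 : (ω v 0).1 = 0 := by omega
  refine h ((Set.finite_singleton v).subset ?_)
  rintro x ⟨hx, -⟩
  rcases Relation.ReflTransGen.cases_head hx with rfl | ⟨c, hc, -⟩
  · rfl
  · exact absurd hc (not_sends_of_count_eq_zero h0 c)

/-- The layers `wakeSet` record first arrival times, but their union forgets time and is the
reachable set of the relation "some frog of `y` visits `z`". -/
theorem wokenSites_eq {n : V → ℕ} {s : V → ℕ → ℕ → V} (h0 : ∀ x i, s x i 0 = x) (v : V) :
    wokenSites n s v =
      {x | Relation.ReflTransGen (fun y z => ∃ i < n y, ∃ j, s y i j = z) v x} := by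
  have hcl : ∀ y ∈ wokenSites n s v, ∀ i < n y, ∀ j, s y i j ∈ wokenSites n s v := by
    intro y hy i hi j
    rcases Nat.eq_zero_or_pos j with rfl | hj
    · rwa [h0]
    obtain ⟨k, hk⟩ := Set.mem_iUnion.1 hy
    -- A site that lies in no layer passes the exclusion clause at every time, so it would belong to
    -- layer `k + j`. This needs `j > 0`; for `j = 0` the frog is still at home.
    by_contra hcon
    have hcon' : ∀ l, s y i j ∉ wakeSet n s v l := fun l hl => hcon (Set.mem_iUnion.2 ⟨l, hl⟩)
    obtain ⟨m, hm⟩ : ∃ m, k + j = m + 1 := ⟨k + j - 1, by omega⟩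
    apply hcon' (m + 1)
    rw [wakeSet]
    refine ⟨fun l => hcon' l, ⟨k, by omega⟩, y, hk, i, hi, ?_⟩
    congr 1
    simp only
    omega
  apply Set.Subset.antisymm
  · intro x hx
    obtain ⟨k, hk⟩ := Set.mem_iUnion.1 hx
    induction k using Nat.strong_induction_on generalizing x with
    | _ k ih =>
      cases k with
      | zero =>
        rw [wakeSet] at hk
        rw [Set.mem_singleton_iff.1 hk]
        exact Relation.ReflTransGen.refl
      | succ j =>
        rw [wakeSet] at hk
        obtain ⟨-, k, y, hy, i, hi, hx⟩ := hk
        exact Relation.ReflTransGen.tail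
          (ih k k.2 (Set.mem_iUnion.2 ⟨_, hy⟩) hy) ⟨i, hi, _, hx⟩
  · intro x hx
    induction hx with
    | refl => exact Set.mem_iUnion.2 ⟨0, by rw [wakeSet]; rfl⟩
    | tail _ hs ih =>
      obtain ⟨i, hi, j, rfl⟩ := hs
      exact hcl _ ih i hi j

theorem isRecurrentSite_iff {ω : V → Site V} (h0 : ∀ x i, (ω x (i + 1)).2 0 = x) (v : V) :
    IsRecurrentSite (fun x => (ω x 0).1) (fun x i => (ω x (i + 1)).2) v ↔ VisitedInf ω v v := by
  rw [IsRecurrentSite, wokenSites_eq h0]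
  rfl

end Deterministic

/-! ### Measurability of the events of the exploration -/

section Measurability

theorem measurableSet_setOf_infinite {V α : Type*} [Countable V] [MeasurableSpace α] {A : α → Set V}
    (h : ∀ x, MeasurableSet {ω | x ∈ A ω}) : MeasurableSet {ω | (A ω).Infinite} := by
  have : {ω | (A ω).Infinite} = ⋂ F : Finset V, ⋃ x, ⋃ _ : x ∉ F, {ω | x ∈ A ω} := by
    ext ω
    simp only [Set.mem_ofPred_eq, Set.mem_iInter, Set.mem_iUnion]
    constructor
    · intro hi F
      obtain ⟨x, hx, hF⟩ := hi.exists_notMem_finset F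
      exact ⟨x, hF, hx⟩
    · intro hi hf
      obtain ⟨x, hx, hA⟩ := hi hf.toFinset
      exact hx (by simpa using hA)
  rw [this]
  exact MeasurableSet.iInter fun F => MeasurableSet.iUnion fun x => MeasurableSet.iUnion fun _ => h x

variable {V : Type*} [Countable V] [MeasurableSpace V] [DiscreteMeasurableSpace V]

theorem measurableSet_sends (x : V) : MeasurableSet {a : Site V | Sends a x} := by
  have : {a : Site V | Sends a x} =
      ⋃ i : ℕ, ⋃ j : ℕ, {a : Site V | i < (a 0).1} ∩ {a : Site V | (a (i + 1)).2 j = x} := by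
    ext a
    simp [Sends]
  rw [this]
  refine MeasurableSet.iUnion fun i => MeasurableSet.iUnion fun j => MeasurableSet.inter ?_ ?_
  · exact measurableSet_lt measurable_const (by fun_prop)
  · have hm : Measurable fun a : Site V => (a (i + 1)).2 j := by fun_prop
    exact hm (measurableSet_singleton x)

theorem measurableSet_sends_apply (y x : V) :
    MeasurableSet {ω : V → Site V | Sends (ω y) x} := by
  have hm : Measurable fun ω : V → Site V => ω y := by fun_prop
  exact hm (measurableSet_sends x)

theorem measurableSet_mem_woken (v x : V) : MeasurableSet {ω : V → Site V | x ∈ woken ω v} := by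
  -- `r n x` is the event that `x` is reached from `v` by a chain of exactly `n` wake-ups.
  let r : ℕ → V → Set (V → Site V) := fun n => Nat.rec (fun x => {_ω | v = x})
    (fun _ s x => ⋃ y, s y ∩ {ω | Sends (ω y) x}) n
  have hr : ∀ n x, MeasurableSet (r n x) := by
    intro n
    induction n with
    | zero => exact fun x => MeasurableSet.const _
    | succ n ih =>
      intro x
      refine MeasurableSet.iUnion fun y => (ih y).inter ?_
      exact measurableSet_sends_apply y x
  have : {ω : V → Site V | x ∈ woken ω v} = ⋃ n, r n x := by
    ext ω
    simp only [Set.mem_ofPred_eq, Set.mem_iUnion]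
    constructor
    · intro h
      induction h with
      | refl => exact ⟨0, rfl⟩
      | tail _ hs ih =>
        obtain ⟨n, hn⟩ := ih
        exact ⟨n + 1, Set.mem_iUnion.2 ⟨_, hn, hs⟩⟩
    · rintro ⟨n, hn⟩
      induction n generalizing x with
      | zero =>
        obtain rfl : v = x := hn
        exact self_mem_woken _ _
      | succ n ih =>
        obtain ⟨y, hy, hs⟩ := Set.mem_iUnion.1 hn
        exact woken_tail (ih y hy) hs
  rw [this]
  exact MeasurableSet.iUnion fun n => hr n x

theorem measurableSet_visitedInf (v w : V) :
    MeasurableSet {ω : V → Site V | VisitedInf ω v w} :=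
  measurableSet_setOf_infinite fun x => (measurableSet_mem_woken v x).inter
    (measurableSet_sends_apply x w)

end Measurability

/-! ### Product measures: Borel-Cantelli along an exploration, and a zero-one law -/

section ProductMeasure

open scoped ENNReal symmDiff
open Filter Topology

variable {ι X : Type*} [MeasurableSpace X] (l : ι → Measure X) [∀ i, IsProbabilityMeasure (l i)]

/-- Overwriting coordinate `u` by a constant leaves a function of the other coordinates only. -/
theorem indepFun_eval_update [DecidableEq ι] (u : ι) (a : X) :
    IndepFun (fun ω : ι → X => ω u) (fun ω : ι → X => Function.update ω u a)
      (Measure.infinitePi l) := by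
  have h : iIndepFun (fun i (ω : ι → X) => ω i) (Measure.infinitePi l) :=
    iIndepFun_infinitePi (X := fun i (x : X) => x) (by fun_prop)
  have h2 := indep_iSup_of_disjoint (fun i => (measurable_pi_apply i).comap_le) h.iIndep
    (S := {u}) (T := {u}ᶜ) disjoint_compl_right
  rw [IndepFun_iff_Indep]
  refine indep_of_indep_of_le_left (indep_of_indep_of_le_right h2 ?_) ?_
  · rw [MeasurableSpace.pi, MeasurableSpace.comap_iSup, iSup_le_iff]
    intro i
    rw [MeasurableSpace.comap_comp]
    by_cases hi : i = u
    · subst hi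
      have : ((fun b : ι → X => b i) ∘ fun ω : ι → X => Function.update ω i a) = fun _ => a := by
        ext ω : 1
        simp
      rw [this, MeasurableSpace.comap_const]
      exact bot_le
    · have : ((fun b : ι → X => b i) ∘ fun ω : ι → X => Function.update ω u a) =
          fun ω => ω i := by
        ext ω : 1
        simp [hi]
      rw [this]
      exact le_iSup₂_of_le (f := fun i (_ : i ∈ ({u}ᶜ : Set ι)) =>
        MeasurableSpace.comap (fun ω : ι → X => ω i) inferInstance) i hi le_rfl
  · exact le_iSup₂_of_le (f := fun i (_ : i ∈ ({u} : Set ι)) =>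
        MeasurableSpace.comap (fun ω : ι → X => ω i) inferInstance) u rfl le_rfl

theorem lintegral_mul_of_update_eq [DecidableEq ι] {f : (ι → X) → ℝ≥0∞} (hf : Measurable f) {u : ι}
    (hfu : ∀ ω a, f (Function.update ω u a) = f ω) {g : X → ℝ≥0∞} (hg : Measurable g) :
    ∫⁻ ω, f ω * g (ω u) ∂(Measure.infinitePi l) =
      (∫⁻ ω, f ω ∂(Measure.infinitePi l)) * ∫⁻ a, g a ∂(l u) := by
  obtain ⟨a⟩ : Nonempty X := nonempty_of_isProbabilityMeasure (l u)
  have hind : IndepFun f (fun ω => g (ω u)) (Measure.infinitePi l) := by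
    have h := (indepFun_eval_update l u a).symm.comp hf hg
    have h1 : (f ∘ fun ω => Function.update ω u a) = f := funext fun ω => hfu ω a
    rwa [h1] at h
  have hg' : Measurable fun ω : ι → X => g (ω u) := by fun_prop
  have := lintegral_mul_eq_lintegral_mul_lintegral_of_indepFun hf hg' hind
  simp only [Pi.mul_apply] at this
  rw [this, ← Measure.infinitePi_map_eval l u, lintegral_map hg (measurable_pi_apply u)]

theorem lintegral_mul_prod_of_update_eq [DecidableEq ι] (F : Finset ι) {f : (ι → X) → ℝ≥0∞}
    (hf : Measurable f) (hfu : ∀ u ∈ F, ∀ ω a, f (Function.update ω u a) = f ω)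
    {d : ι → X → ℝ≥0∞} (hd : ∀ i, Measurable (d i)) (hd1 : ∀ i, ∫⁻ a, d i a ∂(l i) = 1) :
    ∫⁻ ω, f ω * ∏ x ∈ F, d x (ω x) ∂(Measure.infinitePi l) =
      ∫⁻ ω, f ω ∂(Measure.infinitePi l) := by
  induction F using Finset.induction_on with
  | empty => simp
  | insert u F hu ih =>
    have hm : ∀ F : Finset ι, Measurable fun ω : ι → X => ∏ x ∈ F, d x (ω x) := fun F =>
      Finset.measurable_prod _ fun i _ => (hd i).comp (measurable_pi_apply i)
    have : ∀ ω : ι → X, f ω * ∏ x ∈ insert u F, d x (ω x) =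
        (f ω * ∏ x ∈ F, d x (ω x)) * d u (ω u) := by
      intro ω
      rw [Finset.prod_insert hu]
      ring
    simp_rw [this]
    rw [lintegral_mul_of_update_eq l (f := fun ω => f ω * ∏ x ∈ F, d x (ω x)) (hf.mul (hm F)) _
      (hd u), hd1, mul_one]
    · exact ih fun v hv => hfu v (Finset.mem_insert_of_mem hv)
    · intro ω a
      rw [hfu u (Finset.mem_insert_self _ _)]
      congr 1
      refine Finset.prod_congr rfl fun x hx => ?_
      rw [Function.update_of_ne]
      rintro rfl
      exact hu hx

open scoped Classical in
/-- Mean-one weights of the sites in a random set have a mean-one product, if the random set does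
not depend on the values at sites outside of it. -/
theorem lintegral_prod_random_set (E : Finset ι) {A : (ι → X) → Set ι}
    (hA : ∀ x, MeasurableSet {ω | x ∈ A ω})
    (hA' : ∀ ω ω', (∀ x ∈ A ω, ω' x = ω x) → A ω' = A ω)
    {d : ι → X → ℝ≥0∞} (hd : ∀ i, Measurable (d i)) (hd1 : ∀ i, ∫⁻ a, d i a ∂(l i) = 1) :
    ∫⁻ ω, ∏ x ∈ E, (if x ∈ A ω then d x (ω x) else 1) ∂(Measure.infinitePi l) = 1 := by
  have hm : ∀ F : Finset ι, Measurable fun ω : ι → X => ∏ x ∈ F, d x (ω x) := fun F =>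
    Finset.measurable_prod _ fun i _ => (hd i).comp (measurable_pi_apply i)
  let R : Finset ι → Set (ι → X) := fun B => {ω | E.filter (· ∈ A ω) = B}
  have hR : ∀ B, MeasurableSet (R B) := by
    intro B
    have hfin : R B = (⋂ x ∈ E, {ω | x ∈ A ω ↔ x ∈ B}) ∩ {_ω | B ⊆ E} := by
      ext ω
      simp only [R, Set.mem_ofPred_eq, Finset.ext_iff, Finset.mem_filter, Set.mem_inter_iff,
        Set.mem_iInter, Finset.subset_iff]
      constructor
      · exact fun h => ⟨fun x hx => by simpa [hx] using h x, fun x hx => ((h x).2 hx).1⟩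
      · exact fun h x => ⟨fun hx => (h.1 x hx.1).1 hx.2, fun hx => ⟨h.2 hx, (h.1 x (h.2 hx)).2 hx⟩⟩
    rw [hfin]
    refine MeasurableSet.inter (Finset.measurableSet_biInter _ fun x _ => ?_) (MeasurableSet.const _)
    by_cases hx : x ∈ B
    · simpa [hx] using hA x
    · simp only [hx, iff_false]
      exact (hA x).compl
  have hsplit : ∀ G : Finset ι → (ι → X) → ℝ≥0∞, ∀ ω,
      G (E.filter (· ∈ A ω)) ω = ∑ B ∈ E.powerset, (R B).indicator (G B) ω := by
    intro G ω
    rw [Finset.sum_eq_single_of_mem (E.filter (· ∈ A ω))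
      (Finset.mem_powerset.2 (Finset.filter_subset _ _))]
    · rw [Set.indicator_of_mem]
      rfl
    · intro B _ hB
      rw [Set.indicator_of_notMem]
      exact fun h => hB h.symm
  -- Coordinates outside `A ω` do not influence `A`, so on `R B` neither the event nor the product
  -- over `B` depends on the coordinates in `E \ B`. The missing mean-one factors can therefore be
  -- inserted without changing the integral.
  have hkey : ∀ B ∈ E.powerset,
      ∫⁻ ω, (R B).indicator (fun ω => ∏ x ∈ B, d x (ω x)) ω ∂(Measure.infinitePi l) =
      ∫⁻ ω, (R B).indicator (fun ω => ∏ x ∈ E, d x (ω x)) ω ∂(Measure.infinitePi l) := by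
    intro B hB
    rw [← lintegral_mul_prod_of_update_eq l (E \ B) ((hm B).indicator (hR B)) _ hd hd1]
    · refine lintegral_congr fun ω => ?_
      by_cases hω : ω ∈ R B
      · rw [Set.indicator_of_mem hω, Set.indicator_of_mem hω, mul_comm,
          Finset.prod_sdiff (Finset.mem_powerset.1 hB)]
      · rw [Set.indicator_of_notMem hω, Set.indicator_of_notMem hω, zero_mul]
    · intro u hu
      have h1 : ∀ ω a, ω ∈ R B → Function.update ω u a ∈ R B := by
        intro ω a hω
        have huA : u ∉ A ω := by
          intro huA
          refine (Finset.mem_sdiff.1 hu).2 ?_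
          rw [← (show E.filter (· ∈ A ω) = B from hω)]
          exact Finset.mem_filter.2 ⟨(Finset.mem_sdiff.1 hu).1, huA⟩
        have : A (Function.update ω u a) = A ω := by
          refine hA' _ _ fun x hx => Function.update_of_ne ?_ _ _
          rintro rfl
          exact huA hx
        change E.filter (· ∈ A (Function.update ω u a)) = B
        rw [this]
        exact hω
      intro ω a
      have h2 : Function.update ω u a ∈ R B ↔ ω ∈ R B := by
        refine ⟨fun h => ?_, h1 ω a⟩
        simpa using h1 _ (ω u) h
      by_cases hω : ω ∈ R B
      · rw [Set.indicator_of_mem hω, Set.indicator_of_mem (h2.2 hω)]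
        refine Finset.prod_congr rfl fun x hx => ?_
        rw [Function.update_of_ne]
        rintro rfl
        exact (Finset.mem_sdiff.1 hu).2 hx
      · rw [Set.indicator_of_notMem hω, Set.indicator_of_notMem (fun h => hω (h2.1 h))]
  calc ∫⁻ ω, ∏ x ∈ E, (if x ∈ A ω then d x (ω x) else 1) ∂(Measure.infinitePi l)
      = ∫⁻ ω, ∑ B ∈ E.powerset, (R B).indicator (fun ω => ∏ x ∈ B, d x (ω x)) ω
          ∂(Measure.infinitePi l) := by
        refine lintegral_congr fun ω => ?_
        rw [← hsplit (fun B ω => ∏ x ∈ B, d x (ω x)), Finset.prod_filter]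
    _ = ∫⁻ ω, ∑ B ∈ E.powerset, (R B).indicator (fun ω => ∏ x ∈ E, d x (ω x)) ω
          ∂(Measure.infinitePi l) := by
        rw [lintegral_finsetSum _ fun B _ => (hm B).indicator (hR B),
          lintegral_finsetSum _ fun B _ => (hm E).indicator (hR B)]
        exact Finset.sum_congr rfl hkey
    _ = ∫⁻ ω, 1 * ∏ x ∈ E, d x (ω x) ∂(Measure.infinitePi l) := by
        refine lintegral_congr fun ω => ?_
        rw [← hsplit (fun _ ω => ∏ x ∈ E, d x (ω x)), one_mul]
    _ = 1 := by
        rw [lintegral_mul_prod_of_update_eq l E measurable_const (fun _ _ _ _ => rfl) hd hd1]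
        simp

open scoped Classical in
/-- The mean-one weight which penalizes `J`, rewards `H \ J` and is neutral outside of `H`, where
`J` has conditional probability `p` given `H`. -/
noncomputable def splitWeight (p : ℝ≥0∞) (H J : Set X) (a : X) : ℝ≥0∞ :=
  if a ∈ J then (2 - p)⁻¹ else if a ∈ H then 2 * (2 - p)⁻¹ else 1

theorem measurable_splitWeight (p : ℝ≥0∞) {H J : Set X} (hH : MeasurableSet H)
    (hJ : MeasurableSet J) : Measurable (splitWeight p H J) :=
  Measurable.ite hJ measurable_const (Measurable.ite hH measurable_const measurable_const)

theorem lintegral_splitWeight {p : ℝ≥0∞} (hp1 : p ≤ 1) {H J : Set X}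
    (hH : MeasurableSet H) (hJ : MeasurableSet J) (hJH : J ⊆ H) (m : Measure X)
    [IsProbabilityMeasure m] (hm : m J = p * m H) : ∫⁻ a, splitWeight p H J a ∂m = 1 := by
  have hfun : ∀ a, splitWeight p H J a = J.indicator (fun _ => (2 - p)⁻¹) a +
      (H \ J).indicator (fun _ => 2 * (2 - p)⁻¹) a + Hᶜ.indicator (fun _ => 1) a := by
    intro a
    by_cases h1 : a ∈ J
    · simp [splitWeight, h1, hJH h1]
    · by_cases h2 : a ∈ H <;> simp [splitWeight, h1, h2]
  simp_rw [hfun]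
  rw [lintegral_add_right _ (measurable_const.indicator hH.compl),
    lintegral_add_right _ (measurable_const.indicator (hH.diff hJ)),
    lintegral_indicator_const hJ, lintegral_indicator_const (hH.diff hJ),
    lintegral_indicator_const hH.compl, one_mul]
  have hp2 : (2 - p) ≠ 0 := by
    rw [Ne, tsub_eq_zero_iff_le, not_le]
    exact hp1.trans_lt (by norm_num)
  have hpt : (2 - p) ≠ ⊤ := ENNReal.sub_ne_top (by norm_num)
  have hsum : m J + m (H \ J) = m H := by
    rw [← measure_union Set.disjoint_sdiff_right (hH.diff hJ), Set.union_sdiff_cancel hJH]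
  -- This identity fixes the normalization `(2 - p)⁻¹`. Adding `m J` to both sides avoids truncated
  -- subtraction.
  have hkey : m J + 2 * m (H \ J) = (2 - p) * m H := by
    have h1 : (2 - p) * m H + m J = m J + 2 * m (H \ J) + m J := by
      rw [hm, ← add_mul, tsub_add_cancel_of_le (hp1.trans (by norm_num)), ← hm, ← hsum]
      ring
    exact ((ENNReal.add_left_inj (measure_ne_top m J)).1 h1).symm
  have : (2 - p)⁻¹ * m J + 2 * (2 - p)⁻¹ * m (H \ J) = m H := by
    calc _ = (2 - p)⁻¹ * (m J + 2 * m (H \ J)) := by ring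
      _ = m H := by rw [hkey, ← mul_assoc, ENNReal.inv_mul_cancel hp2 hpt, one_mul]
  rw [this, prob_compl_eq_one_sub hH, add_tsub_cancel_of_le prob_le_one]

open scoped Classical in
/-- A conditional Borel-Cantelli lemma for site events along an exploration. -/
theorem ae_infinite_of_infinite [Countable ι] {A : (ι → X) → Set ι}
    (hA : ∀ x, MeasurableSet {ω | x ∈ A ω})
    (hA' : ∀ ω ω', (∀ x ∈ A ω, ω' x = ω x) → A ω' = A ω)
    {p : ℝ≥0∞} (hp0 : p ≠ 0) (hp1 : p ≤ 1) {H J : Set X} (hH : MeasurableSet H)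
    (hJ : MeasurableSet J) (hJH : J ⊆ H) (hlJ : ∀ i, l i J = p * l i H) :
    ∀ᵐ ω ∂(Measure.infinitePi l),
      {x ∈ A ω | ω x ∈ H}.Infinite → {x ∈ A ω | ω x ∈ J}.Infinite := by
  let d : X → ℝ≥0∞ := splitWeight p H J
  have hd : Measurable d := measurable_splitWeight p hH hJ
  have hd1 : ∀ i, ∫⁻ a, d a ∂(l i) = 1 := fun i =>
    lintegral_splitWeight hp1 hH hJ hJH (l i) (hlJ i)
  obtain ⟨E, hE⟩ := (atTop : Filter (Finset ι)).exists_seq_tendsto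
  let M : ℕ → (ι → X) → ℝ≥0∞ := fun k ω => ∏ x ∈ E k, (if x ∈ A ω then d (ω x) else 1)
  have hM : ∀ k, Measurable (M k) := fun k => Finset.measurable_prod _ fun x _ =>
    Measurable.ite (hA x) (hd.comp (measurable_pi_apply x)) measurable_const
  have hM1 : ∀ k, ∫⁻ ω, M k ω ∂(Measure.infinitePi l) = 1 := fun k =>
    lintegral_prod_random_set l (E k) hA hA' (d := fun _ => d) (fun _ => hd) hd1
  -- By Fatou the liminf of the mean-one products is almost surely finite. It is infinite on the bad
  -- event of infinitely many sites in `H` but finitely many in `J`.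
  have hfat : ∫⁻ ω, liminf (fun k => M k ω) atTop ∂(Measure.infinitePi l) ≠ ⊤ := by
    refine ne_top_of_le_ne_top ?_ (lintegral_liminf_le hM)
    simp [hM1]
  have hmeas : Measurable fun ω => liminf (fun k => M k ω) atTop := Measurable.liminf hM
  filter_upwards [ae_lt_top hmeas hfat] with ω hω hHinf
  by_contra hJfin
  rw [Set.not_infinite] at hJfin
  refine hω.ne (Tendsto.liminf_eq ?_)
  set q : ℝ≥0∞ := (2 - p)⁻¹ with hq
  have hpt : (2 - p) ≠ ⊤ := ENNReal.sub_ne_top (by norm_num)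
  have hq0 : q ≠ 0 := ENNReal.inv_ne_zero.2 hpt
  have hqle : q ≤ 1 := by
    rw [hq, ENNReal.inv_le_one]
    refine ENNReal.le_sub_of_add_le_right (ne_top_of_le_ne_top ENNReal.one_ne_top hp1) ?_
    calc 1 + p ≤ 1 + 1 := by gcongr
      _ = 2 := by norm_num
  have h2q : 1 < 2 * q := by
    rw [hq, ← div_eq_mul_inv, ENNReal.lt_div_iff_mul_lt (Or.inr (by norm_num)) (Or.inl hpt), one_mul]
    exact ENNReal.sub_lt_self (by norm_num) (by norm_num) hp0
  let I : Set ι := {x ∈ A ω | ω x ∈ H} \ {x ∈ A ω | ω x ∈ J}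
  have hI : I.Infinite := hHinf.sdiff hJfin
  -- The finitely many sites in `J` cost at most a fixed power of `q`, while each site of the
  -- infinite set `I` contributes `2 * q > 1`; this is where `p ≠ 0` enters.
  have hlow : ∀ k, q ^ hJfin.toFinset.card * (2 * q) ^ ((E k).filter (· ∈ I)).card ≤ M k ω := by
    intro k
    have hfac : ∀ x, (if x ∈ A ω then d (ω x) else 1) =
        (if x ∈ hJfin.toFinset then q else 1) * (if x ∈ I then 2 * q else 1) := by
      intro x
      by_cases hx : x ∈ A ω
      · by_cases h1 : ω x ∈ J
        · simp [d, splitWeight, hx, h1, I, hq]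
        · by_cases h2 : ω x ∈ H <;> simp [d, splitWeight, hx, h1, h2, I, hq]
      · simp [hx, I]
    simp only [M]
    simp_rw [hfac]
    rw [Finset.prod_mul_distrib]
    refine mul_le_mul' ?_ ?_
    · rw [Finset.prod_ite, Finset.prod_const, Finset.prod_const_one, mul_one]
      refine pow_le_pow_right_of_le_one' hqle (Finset.card_le_card ?_)
      exact fun x hx => (Finset.mem_filter.1 hx).2
    · rw [Finset.prod_ite, Finset.prod_const, Finset.prod_const_one, mul_one]
  have hcard : Tendsto (fun k => ((E k).filter (· ∈ I)).card) atTop atTop := by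
    rw [tendsto_atTop]
    intro n
    obtain ⟨t, ht, htn⟩ := hI.exists_subset_card_eq n
    filter_upwards [hE.eventually (eventually_ge_atTop t)] with k hk
    rw [← htn]
    refine Finset.card_le_card fun x hx => Finset.mem_filter.2 ⟨hk hx, ht hx⟩
  have hpow : Tendsto (fun n : ℕ => q ^ hJfin.toFinset.card * (2 * q) ^ n) atTop (𝓝 ⊤) := by
    have := ENNReal.Tendsto.const_mul (a := q ^ hJfin.toFinset.card)
      (ENNReal.tendsto_pow_atTop_nhds_top_iff.2 h2q) (Or.inl (by simp))
    rwa [ENNReal.mul_top (pow_ne_zero _ hq0)] at this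
  exact tendsto_nhds_top_mono' (hpow.comp hcard) hlow

/-- An event which is invariant under transformations that make finitely many coordinates
independent of themselves is trivial. -/
theorem measure_eq_zero_or_one_of_invariant {T : Set (ι → X)} (hT : MeasurableSet T)
    (hinv : ∀ E : Finset ι, ∃ τ : (ι → X) → (ι → X),
      MeasurePreserving τ (Measure.infinitePi l) (Measure.infinitePi l) ∧ τ ⁻¹' T = T ∧
      IndepFun E.restrict (fun ω => E.restrict (τ ω)) (Measure.infinitePi l)) :
    Measure.infinitePi l T = 0 ∨ Measure.infinitePi l T = 1 := by
  set Q := Measure.infinitePi l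
  -- Approximate `T` within `ε` by a cylinder `B`. By invariance of `T`, `B ∩ τ ⁻¹' B` is within `2
  -- * ε` of `T`, and its measure is the square of that of `B`; replacing that square by the one for
  -- `T` costs another `2 * ε`.
  have hkey : ∀ ε > (0 : ℝ), |Q.real T - Q.real T ^ 2| ≤ 4 * ε := by
    intro ε hε
    obtain ⟨B, hBC, hB⟩ := exists_measure_symmDiff_lt_of_generateFrom_isSetRing (μ := Q)
      (isSetRing_measurableCylinders (α := fun _ : ι => X))
      ⟨{Set.univ}, Set.countable_singleton _,
        Set.singleton_subset_iff.2 (univ_mem_measurableCylinders _), by simp⟩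
      generateFrom_measurableCylinders.symm hT (ENNReal.ofReal_pos.2 hε)
    obtain ⟨E, S, hS, rfl⟩ := (mem_measurableCylinders (α := fun _ : ι => X) _).1 hBC
    obtain ⟨τ, hτ, hτT, hτi⟩ := hinv E
    set B : Set (ι → X) := cylinder E S with hBdef
    have hBm : MeasurableSet B := hS.cylinder
    have hBr : Q.real (B ∆ T) ≤ ε := by
      rw [Measure.real]
      exact ENNReal.toReal_le_of_le_ofReal hε.le hB.le
    have h1 : |Q.real B - Q.real T| ≤ ε :=
      (abs_measureReal_sub_le_measureReal_symmDiff hBm.nullMeasurableSet hT.nullMeasurableSet).trans hBr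
    have h2 : Q.real (B ∩ τ ⁻¹' B) = Q.real B ^ 2 := by
      have h := hτi.measure_inter_preimage_eq_mul S S hS hS
      have hpre : Q (τ ⁻¹' B) = Q B := hτ.measure_preimage hBm.nullMeasurableSet
      have : Q (B ∩ τ ⁻¹' B) = Q B * Q (τ ⁻¹' B) := h
      rw [Measure.real, this, hpre, ENNReal.toReal_mul, sq]
      rfl
    have h3 : |Q.real (B ∩ τ ⁻¹' B) - Q.real T| ≤ 2 * ε := by
      have hsub : (B ∩ τ ⁻¹' B) ∆ T ⊆ (B ∆ T) ∪ τ ⁻¹' (B ∆ T) := by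
        intro ω hω
        have hTω : τ ω ∈ T ↔ ω ∈ T := by
          change ω ∈ τ ⁻¹' T ↔ _
          rw [hτT]
        simp only [Set.mem_symmDiff, Set.mem_inter_iff, Set.mem_preimage, Set.mem_union] at hω ⊢
        tauto
      have hBT : MeasurableSet (B ∆ T) := hBm.symmDiff hT
      calc _ ≤ Q.real ((B ∩ τ ⁻¹' B) ∆ T) := abs_measureReal_sub_le_measureReal_symmDiff
              (hBm.inter (hτ.measurable hBm)).nullMeasurableSet hT.nullMeasurableSet
        _ ≤ Q.real ((B ∆ T) ∪ τ ⁻¹' (B ∆ T)) := measureReal_mono hsub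
        _ ≤ Q.real (B ∆ T) + Q.real (τ ⁻¹' (B ∆ T)) := measureReal_union_le _ _
        _ = Q.real (B ∆ T) + Q.real (B ∆ T) := by
            simp only [Measure.real]
            rw [hτ.measure_preimage hBT.nullMeasurableSet]
        _ ≤ 2 * ε := by linarith
    have hB0 : 0 ≤ Q.real B := measureReal_nonneg
    have hT0 : 0 ≤ Q.real T := measureReal_nonneg
    have hB1 : Q.real B ≤ 1 := measureReal_le_one
    have hT1 : Q.real T ≤ 1 := measureReal_le_one
    rw [h2] at h3
    rw [abs_le] at h1 h3 ⊢
    constructor <;> nlinarith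
  have h0 : Q.real T - Q.real T ^ 2 = 0 := by
    by_contra hne
    have hpos : 0 < |Q.real T - Q.real T ^ 2| := abs_pos.2 hne
    have := hkey (|Q.real T - Q.real T ^ 2| / 8) (by positivity)
    linarith
  have h01 : Q.real T * (1 - Q.real T) = 0 := by linarith
  rcases mul_eq_zero.1 h01 with h | h
  · left
    exact (measureReal_eq_zero_iff).1 h
  · right
    have : Q.real T = 1 := by linarith
    rw [← ENNReal.ofReal_toReal (measure_ne_top Q T)]
    change ENNReal.ofReal (Q.real T) = 1
    rw [this, ENNReal.ofReal_one]

end ProductMeasure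

/-! ### Laws of Markov chains on path space -/

section PathLaw

open scoped ENNReal

variable {V : Type*} [MeasurableSpace V]

/-- `ν` is the law of a Markov chain with transition matrix `K` started at `x`. -/
structure IsPathLaw (K : V → V → ℝ) (x : V) (ν : Measure (ℕ → V)) : Prop where
  isProbabilityMeasure : IsProbabilityMeasure ν
  start : ∀ᵐ s ∂ν, s 0 = x
  step : ∀ (n : ℕ) (a : ℕ → V) (y : V), ν {s | (∀ k ≤ n, s k = a k) ∧ s (n + 1) = y} =
    ν {s | ∀ k ≤ n, s k = a k} * ENNReal.ofReal (K (a n) y)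

variable [Countable V] [DiscreteMeasurableSpace V] {K : V → V → ℝ} {x : V}
  {ν ν' : Measure (ℕ → V)}

theorem measurableSet_coord_eq (k : ℕ) (y : V) : MeasurableSet {s : ℕ → V | s k = y} := by
  have hm : Measurable fun s : ℕ → V => s k := by fun_prop
  exact hm (measurableSet_singleton y)

theorem measurableSet_pathCylinder (n : ℕ) (a : ℕ → V) :
    MeasurableSet {s : ℕ → V | ∀ k ≤ n, s k = a k} := by
  have : {s : ℕ → V | ∀ k ≤ n, s k = a k} = ⋂ k, ⋂ _ : k ≤ n, {s | s k = a k} := by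
    ext s
    simp
  rw [this]
  exact MeasurableSet.iInter fun k => MeasurableSet.iInter fun _ => measurableSet_coord_eq k _

theorem measurableSet_pathCylinder_step (n : ℕ) (a : ℕ → V) (y : V) :
    MeasurableSet {s : ℕ → V | (∀ k ≤ n, s k = a k) ∧ s (n + 1) = y} :=
  (measurableSet_pathCylinder n a).inter (measurableSet_coord_eq (n + 1) y)

theorem isPathLaw_map {Ω : Type*} [MeasurableSpace Ω] {P : Measure Ω} [IsProbabilityMeasure P]
    {X : ℕ → Ω → V} (hX : IsMarkovChain P K X) (hx : ∀ ω, X 0 ω = x) :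
    IsPathLaw K x (P.map fun ω j => X j ω) := by
  have hm : Measurable fun ω j => X j ω := measurable_pi_iff.2 hX.1
  refine ⟨Measure.isProbabilityMeasure_map hm.aemeasurable, ?_, fun n a y => ?_⟩
  · rw [ae_map_iff hm.aemeasurable (measurableSet_coord_eq 0 x)]
    exact Filter.Eventually.of_forall hx
  · rw [Measure.map_apply hm (measurableSet_pathCylinder n a),
      Measure.map_apply hm (measurableSet_pathCylinder_step n a y)]
    exact hX.2 n a y

omit [Countable V] [DiscreteMeasurableSpace V] in
theorem IsPathLaw.cylinder_eq (h : IsPathLaw K x ν) (h' : IsPathLaw K x ν') (n : ℕ) (a : ℕ → V) :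
    ν {s | ∀ k ≤ n, s k = a k} = ν' {s | ∀ k ≤ n, s k = a k} := by
  induction n with
  | zero =>
    have h0 : ∀ {ν : Measure (ℕ → V)}, IsPathLaw K x ν →
        ν {s | ∀ k ≤ 0, s k = a k} = ν {_s | x = a 0} := by
      intro ν h
      refine measure_congr ?_
      filter_upwards [h.start] with s hs
      refine propext ?_
      change (∀ k ≤ 0, s k = a k) ↔ x = a 0
      simp [hs]
    have := h.isProbabilityMeasure
    have := h'.isProbabilityMeasure
    rw [h0 h, h0 h']
    by_cases hx : x = a 0 <;> simp [hx]
  | succ n ih =>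
    have : {s : ℕ → V | ∀ k ≤ n + 1, s k = a k} =
        {s | (∀ k ≤ n, s k = a k) ∧ s (n + 1) = a (n + 1)} := by
      ext s
      simp only [Set.mem_ofPred_eq]
      constructor
      · exact fun hs => ⟨fun k hk => hs k (by omega), hs _ le_rfl⟩
      · rintro ⟨h1, h2⟩ k hk
        rcases Nat.lt_or_ge n k with hk' | hk'
        · obtain rfl : k = n + 1 := by omega
          exact h2
        · exact h1 k hk'
    rw [this, h.step, h'.step, ih]

theorem generateFrom_pathCylinder :
    (inferInstance : MeasurableSpace (ℕ → V)) = MeasurableSpace.generateFrom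
      {A | ∃ (n : ℕ) (a : ℕ → V), A = {s | ∀ k ≤ n, s k = a k}} := by
  apply le_antisymm
  · refine iSup_le fun i => ?_
    rintro _ ⟨t, -, rfl⟩
    -- Indexing by finite prefixes keeps the union countable. `Fin.ofNat` extends a prefix
    -- periodically, but only its values up to `i` are used.
    have : (fun s : ℕ → V => s i) ⁻¹' t = ⋃ a : {a : Fin (i + 1) → V // a (Fin.last i) ∈ t},
        {s | ∀ k ≤ i, s k = a.1 (Fin.ofNat (i + 1) k)} := by
      ext s
      simp only [Set.mem_preimage, Set.mem_iUnion, Set.mem_ofPred_eq]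
      have hlast : Fin.ofNat (i + 1) i = Fin.last i := by
        ext
        simp
      constructor
      · intro hs
        refine ⟨⟨fun k => s k, by simpa using hs⟩, fun k hk => ?_⟩
        simp [Nat.mod_eq_of_lt (show k < i + 1 by omega)]
      · rintro ⟨⟨a, ha⟩, h⟩
        rw [h i le_rfl, hlast]
        exact ha
    rw [this]
    refine MeasurableSet.iUnion fun a => MeasurableSpace.measurableSet_generateFrom ?_
    exact ⟨i, fun k => a.1 (Fin.ofNat (i + 1) k), rfl⟩
  · refine MeasurableSpace.generateFrom_le ?_
    rintro _ ⟨n, a, rfl⟩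
    exact measurableSet_pathCylinder n a

-- Two path cylinders are either disjoint or nested.
omit [MeasurableSpace V] [Countable V] [DiscreteMeasurableSpace V] in
theorem isPiSystem_pathCylinder :
    IsPiSystem {A : Set (ℕ → V) | ∃ (n : ℕ) (a : ℕ → V), A = {s | ∀ k ≤ n, s k = a k}} := by
  have key : ∀ (n m : ℕ) (a b : ℕ → V), n ≤ m →
      ({s : ℕ → V | ∀ k ≤ n, s k = a k} ∩ {s | ∀ k ≤ m, s k = b k}).Nonempty →
      {s : ℕ → V | ∀ k ≤ n, s k = a k} ∩ {s | ∀ k ≤ m, s k = b k} =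
        {s | ∀ k ≤ m, s k = b k} := by
    rintro n m a b hnm ⟨s, h1, h2⟩
    refine Set.inter_eq_right.2 fun r hr k hk => ?_
    rw [hr k (hk.trans hnm), ← h2 k (hk.trans hnm), h1 k hk]
  rintro _ ⟨n, a, rfl⟩ _ ⟨m, b, rfl⟩ hne
  rcases le_total n m with h | h
  · exact ⟨m, b, key n m a b h hne⟩
  · rw [Set.inter_comm] at hne ⊢
    exact ⟨n, a, key m n b a h hne⟩

theorem IsPathLaw.unique (h : IsPathLaw K x ν) (h' : IsPathLaw K x ν') : ν = ν' := by
  have := h.isProbabilityMeasure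
  have := h'.isProbabilityMeasure
  refine ext_of_generate_finite _ generateFrom_pathCylinder isPiSystem_pathCylinder ?_ (by simp)
  rintro _ ⟨n, a, rfl⟩
  exact h.cylinder_eq h' n a

theorem IsPathLaw.map_perm (h : IsPathLaw K x ν) (φ : Equiv.Perm V)
    (hφ : ∀ u v, K (φ u) (φ v) = K u v) : IsPathLaw K (φ x) (ν.map fun s j => φ (s j)) := by
  have := h.isProbabilityMeasure
  have hm : Measurable fun (s : ℕ → V) j => φ (s j) := by
    refine measurable_pi_iff.2 fun j => ?_
    exact (Measurable.of_discrete (f := φ)).comp (measurable_pi_apply j)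
  refine ⟨Measure.isProbabilityMeasure_map hm.aemeasurable, ?_, fun n a y => ?_⟩
  · rw [ae_map_iff hm.aemeasurable (measurableSet_coord_eq 0 _)]
    filter_upwards [h.start] with s hs
    rw [hs]
  · rw [Measure.map_apply hm (measurableSet_pathCylinder n a), Measure.map_apply hm
      (measurableSet_pathCylinder_step n a y)]
    have := h.step n (fun k => φ.symm (a k)) (φ.symm y)
    rw [← hφ, φ.apply_symm_apply, φ.apply_symm_apply] at this
    simpa [Equiv.eq_symm_apply] using this

/-- The path which starts at `x` and continues with `s`. -/
def consPath (x : V) (s : ℕ → V) (j : ℕ) : V := Nat.casesOn j x s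

omit [Countable V] [DiscreteMeasurableSpace V] in
theorem measurable_consPath (x : V) : Measurable (consPath x) := by
  refine measurable_pi_iff.2 fun j => ?_
  cases j with
  | zero => exact measurable_const
  | succ j => exact measurable_pi_apply j

/-- First step decomposition of the law of a Markov chain. -/
theorem IsPathLaw.eq_sum (hK : IsStochastic K) {ν : V → Measure (ℕ → V)}
    (h : ∀ y, IsPathLaw K y (ν y)) (x : V) :
    ν x = Measure.sum fun y => ENNReal.ofReal (K x y) • (ν y).map (consPath x) := by
  -- By uniqueness it suffices that the mixture is itself a path law from `x`: its first transition
  -- is given by the weights `K x y`, its later ones by those of `ν y`.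
  refine (h x).unique ?_
  have hprob := fun y => (h y).isProbabilityMeasure
  have hap : ∀ A : Set (ℕ → V), MeasurableSet A →
      Measure.sum (fun y => ENNReal.ofReal (K x y) • (ν y).map (consPath x)) A =
        ∑' y, ENNReal.ofReal (K x y) * ν y (consPath x ⁻¹' A) := by
    intro A hA
    rw [Measure.sum_apply _ hA]
    refine tsum_congr fun y => ?_
    rw [Measure.smul_apply, Measure.map_apply (measurable_consPath x) hA, smul_eq_mul]
  refine ⟨⟨?_⟩, ?_, fun n a y => ?_⟩
  · rw [hap _ MeasurableSet.univ]
    simp only [Set.preimage_univ, measure_univ, mul_one]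
    rw [← ENNReal.ofReal_tsum_of_nonneg (hK.1 x) (hK.2 x).summable, (hK.2 x).tsum_eq,
      ENNReal.ofReal_one]
  · have h0 : MeasurableSet {s : ℕ → V | ¬ s 0 = x} := (measurableSet_coord_eq 0 x).compl
    rw [ae_iff, hap _ h0]
    have : consPath x ⁻¹' {s | ¬ s 0 = x} = ∅ := by
      ext s
      simp [consPath]
    simp [this]
  · rw [hap _ (measurableSet_pathCylinder n a),
      hap _ (measurableSet_pathCylinder_step n a y),
      ← ENNReal.tsum_mul_right]
    by_cases hx : x = a 0
    · cases n with
      | zero =>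
        have h1 : ∀ z, ν z (consPath x ⁻¹' {s | (∀ k ≤ 0, s k = a k) ∧ s (0 + 1) = y}) =
            ν z {_s | z = y} := by
          intro z
          refine measure_congr ?_
          filter_upwards [(h z).start] with s hs
          refine propext ?_
          change ((∀ k ≤ 0, consPath x s k = a k) ∧ s 0 = y) ↔ z = y
          simp [hs, consPath, hx]
        have h2 : ∀ z, ν z (consPath x ⁻¹' {s | ∀ k ≤ 0, s k = a k}) = 1 := by
          intro z
          have : consPath x ⁻¹' {s | ∀ k ≤ 0, s k = a k} = Set.univ := by
            ext s
            simp [consPath, hx]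
          rw [this, measure_univ]
        simp_rw [h1, h2, mul_one]
        rw [tsum_eq_single y, ENNReal.tsum_mul_right,
          ← ENNReal.ofReal_tsum_of_nonneg (hK.1 x) (hK.2 x).summable, (hK.2 x).tsum_eq, hx]
        · simp
        · intro z hz
          simp [hz]
      | succ n =>
        refine tsum_congr fun z => ?_
        have h1 : consPath x ⁻¹' {s | (∀ k ≤ n + 1, s k = a k) ∧ s (n + 1 + 1) = y} =
            {s | (∀ k ≤ n, s k = a (k + 1)) ∧ s (n + 1) = y} := by
          ext s
          simp only [Set.mem_preimage, Set.mem_ofPred_eq]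
          refine and_congr_left fun _ => ⟨fun hs k hk => hs (k + 1) (by omega), fun hs k hk => ?_⟩
          cases k with
          | zero => exact hx
          | succ k => exact hs k (by omega)
        have h2 : consPath x ⁻¹' {s | ∀ k ≤ n + 1, s k = a k} =
            {s | ∀ k ≤ n, s k = a (k + 1)} := by
          ext s
          simp only [Set.mem_preimage, Set.mem_ofPred_eq]
          refine ⟨fun hs k hk => hs (k + 1) (by omega), fun hs k hk => ?_⟩
          cases k with
          | zero => exact hx
          | succ k => exact hs k (by omega)
        rw [h1, h2, (h z).step n (fun k => a (k + 1)) y, mul_assoc]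
    · have h1 : consPath x ⁻¹' {s | (∀ k ≤ n, s k = a k) ∧ s (n + 1) = y} = ∅ := by
        ext s
        simp only [Set.mem_preimage, Set.mem_ofPred_eq, Set.mem_empty_iff_false, iff_false]
        exact fun hs => hx (hs.1 0 (Nat.zero_le _))
      have h2 : consPath x ⁻¹' {s | ∀ k ≤ n, s k = a k} = ∅ := by
        ext s
        simp only [Set.mem_preimage, Set.mem_ofPred_eq, Set.mem_empty_iff_false, iff_false]
        exact fun hs => hx (hs 0 (Nat.zero_le _))
      erw [h1, h2]
      simp

omit [Countable V] in
theorem measurableSet_hits (D : Set V) :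
    MeasurableSet {s : ℕ → V | ∃ j, s j ∈ D} := by
  have : {s : ℕ → V | ∃ j, s j ∈ D} = ⋃ j, {s | s j ∈ D} := by
    ext s
    simp
  rw [this]
  exact MeasurableSet.iUnion fun j => (measurable_pi_apply j) (MeasurableSet.of_discrete (s := D))

omit [Countable V] in
theorem IsPathLaw.hits_eq_one (h : IsPathLaw K x ν) {D : Set V} (hx : x ∈ D) :
    ν {s | ∃ j, s j ∈ D} = 1 := by
  have := h.isProbabilityMeasure
  rw [← mem_ae_iff_prob_eq_one (measurableSet_hits D)]
  filter_upwards [h.start] with s hs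
  exact ⟨0, hs ▸ hx⟩

/-- Hitting probabilities are superharmonic: by the first step decomposition the left side is the
probability of hitting `D` at a time at least one. -/
theorem IsPathLaw.sum_hits_le (hK : IsStochastic K) {ν : V → Measure (ℕ → V)}
    (h : ∀ y, IsPathLaw K y (ν y)) (D : Set V) (x : V) :
    ∑' y, ENNReal.ofReal (K x y) * ν y {s | ∃ j, s j ∈ D} ≤ ν x {s | ∃ j, s j ∈ D} := by
  conv_rhs => rw [IsPathLaw.eq_sum hK h x, Measure.sum_apply _ (measurableSet_hits D)]
  refine ENNReal.tsum_le_tsum fun y => ?_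
  rw [Measure.smul_apply, Measure.map_apply (measurable_consPath x) (measurableSet_hits D),
    smul_eq_mul]
  gcongr
  rintro s ⟨j, hj⟩
  exact ⟨j + 1, hj⟩

/-- The Markov property at time `n` for an event which depends on the path up to time `n`. -/
theorem IsPathLaw.step_of_past (h : IsPathLaw K x ν) (n : ℕ) (S : Set (Fin (n + 1) → V)) (w y : V)
    (hS : ∀ a ∈ S, a (Fin.last n) = w) :
    ν {s | (fun k : Fin (n + 1) => s k) ∈ S ∧ s (n + 1) = y} =
      ENNReal.ofReal (K w y) * ν {s | (fun k : Fin (n + 1) => s k) ∈ S} := by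
  have hcyl : ∀ a : Fin (n + 1) → V, {s : ℕ → V | (fun k : Fin (n + 1) => s k) = a} =
      {s | ∀ k ≤ n, s k = a (Fin.ofNat (n + 1) k)} := by
    intro a
    ext s
    simp only [Set.mem_ofPred_eq]
    constructor
    · rintro rfl k hk
      simp [Nat.mod_eq_of_lt (show k < n + 1 by omega)]
    · intro hs
      ext k
      rw [hs k (by omega)]
      congr 1
      ext
      simp
  have hlast : Fin.ofNat (n + 1) n = Fin.last n := by
    ext
    simp
  have h1 : {s : ℕ → V | (fun k : Fin (n + 1) => s k) ∈ S} =
      ⋃ a : S, {s : ℕ → V | (fun k : Fin (n + 1) => s k) = a} := by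
    ext s
    simp
  have h2 : {s : ℕ → V | (fun k : Fin (n + 1) => s k) ∈ S ∧ s (n + 1) = y} =
      ⋃ a : S, {s : ℕ → V | (fun k : Fin (n + 1) => s k) = a} ∩ {s | s (n + 1) = y} := by
    ext s
    simp
  have hdisj : Pairwise (Function.onFun Disjoint
      fun a : S => {s : ℕ → V | (fun k : Fin (n + 1) => s k) = a}) := by
    intro a b hab
    refine Set.disjoint_left.2 fun s ha hb => hab (Subtype.ext ?_)
    exact (show _ = _ from ha).symm.trans hb
  have hmeas : ∀ a : Fin (n + 1) → V,
      MeasurableSet {s : ℕ → V | (fun k : Fin (n + 1) => s k) = a} := by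
    intro a
    rw [hcyl a]
    exact measurableSet_pathCylinder n _
  rw [h1, h2, measure_iUnion hdisj fun a => hmeas a, measure_iUnion
    (fun a b hab => (hdisj hab).mono Set.inter_subset_left Set.inter_subset_left)
    fun a => (hmeas a).inter (measurableSet_coord_eq _ _), ← ENNReal.tsum_mul_left]
  refine tsum_congr fun a => ?_
  have := h.step n (fun k => a.1 (Fin.ofNat (n + 1) k)) y
  rw [hlast, hS a.1 a.2] at this
  rw [hcyl, mul_comm, ← this]
  rfl

/-- The path `s` visits `w` for the first time at time `j`. -/
def FirstHit (w : V) (j : ℕ) (s : ℕ → V) : Prop := s j = w ∧ ∀ k < j, s k ≠ w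

theorem measurableSet_firstHit (w : V) (j : ℕ) : MeasurableSet {s | FirstHit w j s} := by
  have : {s | FirstHit w j s} = {s | s j = w} ∩ ⋂ k, ⋂ _ : k < j, {s | s k = w}ᶜ := by
    ext s
    simp [FirstHit]
  rw [this]
  exact (measurableSet_coord_eq j w).inter (MeasurableSet.iInter fun k =>
    MeasurableSet.iInter fun _ => (measurableSet_coord_eq k w).compl)

theorem IsPathLaw.firstHit_step (h : IsPathLaw K x ν) (w y : V) (j : ℕ) :
    ν {s | FirstHit w j s ∧ s (j + 1) = y} =
      ENNReal.ofReal (K w y) * ν {s | FirstHit w j s} := by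
  have hS : ∀ s : ℕ → V, (fun k : Fin (j + 1) => s k) ∈
      {a : Fin (j + 1) → V | a (Fin.last j) = w ∧ ∀ k : Fin (j + 1), (k : ℕ) < j → a k ≠ w} ↔
      FirstHit w j s := by
    intro s
    refine and_congr Iff.rfl ⟨fun hs k hk => hs ⟨k, by omega⟩ hk, fun hs k hk => hs k hk⟩
  have := h.step_of_past j {a : Fin (j + 1) → V | a (Fin.last j) = w ∧
    ∀ k : Fin (j + 1), (k : ℕ) < j → a k ≠ w} w y (fun a ha => ha.1)
  simpa only [hS] using this

end PathLaw

/-! ### The first frog of a site to visit `w`, and its next step -/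

section SiteLaw

open scoped ENNReal

variable {V : Type*} [MeasurableSpace V] [Countable V] [DiscreteMeasurableSpace V]

/-- The frog with index `i` is the first one which visits `w`, for the first time at time `j`. -/
def firstVisit (w : V) (i j : ℕ) : Set (Site V) :=
  {a | i < (a 0).1 ∧ (∀ i' < i, ∀ k, (a (i' + 1)).2 k ≠ w) ∧ FirstHit w j (a (i + 1)).2}

/-- The first frog that visits `w` moves to `y` right after its first visit. -/
def firstVisitStep (w y : V) : Set (Site V) :=
  ⋃ q : ℕ × ℕ, firstVisit w q.1 q.2 ∩ {a | (a (q.1 + 1)).2 (q.2 + 1) = y}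

omit [MeasurableSpace V] [Countable V] [DiscreteMeasurableSpace V] in
theorem iUnion_firstVisit (w : V) : ⋃ q : ℕ × ℕ, firstVisit w q.1 q.2 = {a | Sends a w} := by
  classical
  ext a
  simp only [Set.mem_iUnion, Set.mem_ofPred_eq]
  constructor
  · rintro ⟨⟨i, j⟩, h1, -, h2⟩
    exact ⟨i, h1, j, h2.1⟩
  · intro h
    -- The search runs over all paths, including those of indices at or above the frog count; the
    -- least index is still below the count, since some index below it works.
    have h' : ∃ i, ∃ j, (a (i + 1)).2 j = w := by
      obtain ⟨i, -, hi⟩ := h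
      exact ⟨i, hi⟩
    refine ⟨(Nat.find h', Nat.find (Nat.find_spec h')), ?_, ?_, Nat.find_spec (Nat.find_spec h'),
      fun k hk => Nat.find_min _ hk⟩
    · obtain ⟨i, hi, hj⟩ := h
      exact (Nat.find_min' h' hj).trans_lt hi
    · intro i hi k hk
      exact Nat.find_min h' hi ⟨k, hk⟩

omit [MeasurableSpace V] [Countable V] [DiscreteMeasurableSpace V] in
theorem pairwise_disjoint_firstVisit (w : V) :
    Pairwise (Function.onFun Disjoint fun q : ℕ × ℕ => firstVisit w q.1 q.2) := by
  rintro ⟨i, j⟩ ⟨i', j'⟩ hne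
  refine Set.disjoint_left.2 fun a h h' => hne ?_
  obtain ⟨h1, h2, h3⟩ := h
  obtain ⟨h1', h2', h3'⟩ := h'
  simp only at h1 h2 h3 h1' h2' h3'
  have hi : i = i' := by
    rcases lt_trichotomy i i' with hlt | heq | hlt
    · exact absurd h3.1 (h2' i hlt j)
    · exact heq
    · exact absurd h3'.1 (h2 i' hlt j')
  subst hi
  have hj : j = j' := by
    rcases lt_trichotomy j j' with hlt | heq | hlt
    · exact absurd h3.1 (h3'.2 j hlt)
    · exact heq
    · exact absurd h3'.1 (h3.2 j' hlt)
  rw [hj]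

omit [MeasurableSpace V] [Countable V] [DiscreteMeasurableSpace V] in
theorem firstVisitStep_subset (w y : V) : firstVisitStep w y ⊆ {a | Sends a w} := by
  rw [← iUnion_firstVisit]
  exact Set.iUnion_mono fun q => Set.inter_subset_left

omit [MeasurableSpace V] [Countable V] [DiscreteMeasurableSpace V] in
theorem sends_of_mem_firstVisitStep {w y : V} {a : Site V} (h : a ∈ firstVisitStep w y) :
    Sends a y := by
  obtain ⟨q, hq, hy⟩ := Set.mem_iUnion.1 h
  exact ⟨q.1, hq.1, q.2 + 1, hy⟩

theorem measurableSet_firstVisit (w : V) (i j : ℕ) : MeasurableSet (firstVisit w i j) := by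
  have : firstVisit w i j = {a | i < (a 0).1} ∩ ((⋂ i', ⋂ _ : i' < i, ⋂ k,
      {a : Site V | (a (i' + 1)).2 ∈ {s : ℕ → V | s k = w}ᶜ}) ∩
      {a | (a (i + 1)).2 ∈ {s | FirstHit w j s}}) := by
    ext a
    simp [firstVisit]
  rw [this]
  have hm : ∀ i, Measurable fun a : Site V => (a i).2 := fun i => by fun_prop
  refine (measurableSet_lt measurable_const (by fun_prop)).inter (MeasurableSet.inter ?_ ?_)
  · exact MeasurableSet.iInter fun i' => MeasurableSet.iInter fun _ => MeasurableSet.iInter fun k =>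
      hm _ (measurableSet_coord_eq k w).compl
  · exact hm _ (measurableSet_firstHit w j)

theorem measurableSet_firstVisit_step (w y : V) (i j : ℕ) :
    MeasurableSet (firstVisit w i j ∩ {a | (a (i + 1)).2 (j + 1) = y}) := by
  have hm : Measurable fun a : Site V => (a (i + 1)).2 := by fun_prop
  exact (measurableSet_firstVisit w i j).inter (hm (measurableSet_coord_eq (j + 1) y))

theorem measurableSet_firstVisitStep (w y : V) : MeasurableSet (firstVisitStep w y) :=
  MeasurableSet.iUnion fun q => measurableSet_firstVisit_step w y q.1 q.2

/-- Both events are rectangles in the independent entries `0, …, i + 1` and differ only in the last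
factor, where the Markov property at the first hitting time applies. -/
theorem measure_firstVisit_step {K : V → V → ℝ} {x : V} (m : ℕ → Measure (ℕ × (ℕ → V)))
    [∀ i, IsProbabilityMeasure (m i)] (hm : ∀ i, IsPathLaw K x ((m (i + 1)).map Prod.snd))
    (w y : V) (i j : ℕ) :
    Measure.infinitePi m (firstVisit w i j ∩ {a | (a (i + 1)).2 (j + 1) = y}) =
      ENNReal.ofReal (K w y) * Measure.infinitePi m (firstVisit w i j) := by
  let t : Set (ℕ → V) → ℕ → Set (ℕ × (ℕ → V)) := fun B k => Nat.casesOn k {z | i < z.1}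
    fun k => if k = i then Prod.snd ⁻¹' B else Prod.snd ⁻¹' (⋂ k, {s : ℕ → V | s k = w}ᶜ)
  have ht : ∀ B, MeasurableSet B → ∀ k, MeasurableSet (t B k) := by
    intro B hB k
    cases k with
    | zero => exact measurableSet_lt measurable_const measurable_fst
    | succ k =>
      by_cases hk : k = i
      · simp only [t, hk, if_true]
        exact measurable_snd hB
      · simp only [t, hk, if_false]
        exact measurable_snd (MeasurableSet.iInter fun k => (measurableSet_coord_eq k w).compl)
  have hpi : ∀ B : Set (ℕ → V), Set.pi (Finset.range (i + 2)) (t B) =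
      {a : Site V | i < (a 0).1 ∧ (∀ i' < i, ∀ k, (a (i' + 1)).2 k ≠ w) ∧ (a (i + 1)).2 ∈ B} := by
    intro B
    ext a
    simp only [Set.mem_pi, Finset.coe_range, Set.mem_Iio, Set.mem_ofPred_eq]
    constructor
    · intro h
      refine ⟨h 0 (by omega), fun i' hi' k => ?_, ?_⟩
      · have := h (i' + 1) (by omega)
        simp only [t, hi'.ne, if_false] at this
        exact Set.mem_iInter.1 this k
      · have := h (i + 1) (by omega)
        simp only [t, if_true] at this
        exact this
    · rintro ⟨h1, h2, h3⟩ k hk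
      cases k with
      | zero => exact h1
      | succ k =>
        by_cases hki : k = i
        · subst hki
          simp only [t, if_true]
          exact h3
        · simp only [t, hki, if_false]
          exact Set.mem_iInter.2 fun l => h2 k (by omega) l
  have hval : ∀ B : Set (ℕ → V), MeasurableSet B →
      Measure.infinitePi m (Set.pi (Finset.range (i + 2)) (t B)) =
        (∏ k ∈ Finset.range (i + 1), m k (t ∅ k)) * (m (i + 1)).map Prod.snd B := by
    intro B hB
    rw [Measure.infinitePi_pi _ fun k _ => ht B hB k, Finset.prod_range_succ,
      Measure.map_apply measurable_snd hB]
    congr 1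
    · refine Finset.prod_congr rfl fun k hk => ?_
      cases k with
      | zero => rfl
      | succ k =>
        have : k ≠ i := by
          have := Finset.mem_range.1 hk
          omega
        simp only [t, this, if_false]
    · simp only [t, if_true]
  have h1 : firstVisit w i j = Set.pi (Finset.range (i + 2)) (t {s | FirstHit w j s}) := by
    rw [hpi]
    rfl
  have h2 : firstVisit w i j ∩ {a | (a (i + 1)).2 (j + 1) = y} =
      Set.pi (Finset.range (i + 2)) (t {s | FirstHit w j s ∧ s (j + 1) = y}) := by
    rw [hpi]
    ext a
    simp only [firstVisit, Set.mem_inter_iff, Set.mem_ofPred_eq]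
    tauto
  have hms : MeasurableSet {s | FirstHit w j s ∧ s (j + 1) = y} :=
    (measurableSet_firstHit w j).inter (measurableSet_coord_eq (j + 1) y)
  rw [h2, h1, hval _ (measurableSet_firstHit w j), hval _ hms, (hm i).firstHit_step w y j]
  ring

/-- Summing over the disjoint cases of which frog comes first and when. The ratio `K w y` is the
same for every site `x`, as the Borel-Cantelli lemma requires. -/
theorem measure_firstVisitStep {K : V → V → ℝ} {x : V} (m : ℕ → Measure (ℕ × (ℕ → V)))
    [∀ i, IsProbabilityMeasure (m i)] (hm : ∀ i, IsPathLaw K x ((m (i + 1)).map Prod.snd))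
    (w y : V) :
    Measure.infinitePi m (firstVisitStep w y) =
      ENNReal.ofReal (K w y) * Measure.infinitePi m {a | Sends a w} := by
  rw [← iUnion_firstVisit, firstVisitStep, measure_iUnion (pairwise_disjoint_firstVisit w)
    fun q => measurableSet_firstVisit w q.1 q.2, measure_iUnion
    (fun a b hab => (pairwise_disjoint_firstVisit w hab).mono Set.inter_subset_left
      Set.inter_subset_left) fun q => measurableSet_firstVisit_step w y q.1 q.2,
    ← ENNReal.tsum_mul_left]
  exact tsum_congr fun q => measure_firstVisit_step m hm w y q.1 q.2

end SiteLaw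

/-! ### Orbits, the factor chain and harmonic functions -/

section FactorChain

open scoped ENNReal Pointwise

variable {V : Type*}

/-- A consequence of B. H. Neumann's covering lemma: if all orbits are infinite, then every finite
set can be moved away from itself. -/
theorem exists_translate_disjoint (Φ : Subgroup (Equiv.Perm V))
    (horb : ∀ x : V, (MulAction.orbit Φ x).Infinite) (E : Finset V) :
    ∃ g ∈ Φ, ∀ x ∈ E, g x ∉ E := by
  classical
  by_contra! hcon
  let s : Finset (V × V) := (E ×ˢ E).filter fun q => ∃ g : Φ, g • q.1 = q.2
  have hg : ∀ q : V × V, ∃ g : Φ, q ∈ s → g • q.1 = q.2 := by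
    intro q
    by_cases hq : q ∈ s
    · obtain ⟨g, hg⟩ := (Finset.mem_filter.1 hq).2
      exact ⟨g, fun _ => hg⟩
    · exact ⟨1, fun h => absurd h hq⟩
  choose g hg using hg
  -- The elements moving `x` to a given `y` form a left coset of the stabilizer of `x`. If no
  -- element moves `E` off itself, finitely many such cosets cover `Φ`, so some stabilizer has
  -- finite index and its orbit is finite.
  have hcov : ⋃ q ∈ s, g q • (MulAction.stabilizer Φ q.1 : Set Φ) = Set.univ := by
    refine Set.eq_univ_of_forall fun f => ?_
    obtain ⟨x, hx, hfx⟩ := hcon f f.2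
    have hq : (x, f • x) ∈ s :=
      Finset.mem_filter.2 ⟨Finset.mem_product.2 ⟨hx, hfx⟩, f, rfl⟩
    refine Set.mem_iUnion₂.2 ⟨(x, f • x), hq, ?_⟩
    rw [mem_leftCoset_iff, SetLike.mem_coe, MulAction.mem_stabilizer_iff, mul_smul,
      inv_smul_eq_iff]
    exact (hg _ hq).symm
  obtain ⟨q, -, hq⟩ := Subgroup.exists_finiteIndex_of_leftCoset_cover hcov
  refine hq.index_ne_zero ?_
  rw [MulAction.index_stabilizer]
  exact (horb q.1).ncard

variable {Φ : Subgroup (Equiv.Perm V)} {K : V → V → ℝ} (hK : IsStochastic K)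
  (hΦ : IsInvariantUnder Φ K)

theorem tsum_orbits (f : V → ℝ≥0∞) : ∑' b : Orbits Φ, ∑' z : b.orbit, f z = ∑' z, f z := by
  rw [← (Equiv.sigmaFiberEquiv (Quotient.mk'' : V → Orbits Φ)).tsum_eq f, ENNReal.tsum_sigma']
  refine tsum_congr fun b => ?_
  have h : ∀ z : V, z ∈ b.orbit ↔ (Quotient.mk'' z : Orbits Φ) = b := fun z =>
    MulAction.orbitRel.Quotient.mem_orbit
  exact (Equiv.subtypeEquivRight h).tsum_eq (fun z => f z.1)

theorem factorMatrix_mk (x : V) (b : Orbits Φ) :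
    factorMatrix Φ K hΦ (Quotient.mk'' x) b = ∑' z : b.orbit, K x z := rfl

include hK in
theorem factorMatrix_nonneg (a b : Orbits Φ) : 0 ≤ factorMatrix Φ K hΦ a b := by
  induction a using Quotient.inductionOn' with
  | _ x => exact tsum_nonneg fun z => hK.1 x z

include hK in
theorem ofReal_factorMatrix (x : V) (b : Orbits Φ) :
    ENNReal.ofReal (factorMatrix Φ K hΦ (Quotient.mk'' x) b) =
      ∑' z : b.orbit, ENNReal.ofReal (K x z) := by
  rw [factorMatrix_mk]
  exact ENNReal.ofReal_tsum_of_nonneg (f := fun z : b.orbit => K x z) (fun z => hK.1 x z)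
    ((hK.2 x).summable.subtype b.orbit)

include hK in
theorem tsum_ofReal_eq_one (x : V) : ∑' y, ENNReal.ofReal (K x y) = 1 := by
  rw [← ENNReal.ofReal_tsum_of_nonneg (hK.1 x) (hK.2 x).summable, (hK.2 x).tsum_eq,
    ENNReal.ofReal_one]

include hK in
theorem tsum_mul_lift (F : Orbits Φ → ℝ≥0∞) (x : V) :
    ∑' y, ENNReal.ofReal (K x y) * F (Quotient.mk'' y) =
      ∑' b, ENNReal.ofReal (factorMatrix Φ K hΦ (Quotient.mk'' x) b) * F b := by
  rw [← tsum_orbits (Φ := Φ)]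
  refine tsum_congr fun b => ?_
  rw [ofReal_factorMatrix hK, ← ENNReal.tsum_mul_right]
  refine tsum_congr fun z => ?_
  have hz : (Quotient.mk'' z.1 : Orbits Φ) = b := MulAction.orbitRel.Quotient.mem_orbit.1 z.2
  rw [hz]

-- Positive mass propagates along steps of positive `K`-probability, which project to positive
-- entries of the factor matrix.
include hK in
theorem invariantProbability_pos (hirr : IsIrreducible K) {μ : Orbits Φ → ℝ}
    (hμ : IsInvariantProbability (factorMatrix Φ K hΦ) μ) (a : Orbits Φ) : 0 < μ a := by
  obtain ⟨h0, h1, h2⟩ := hμ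
  obtain ⟨b, hb⟩ : ∃ b, 0 < μ b := by
    by_contra! hcon
    have : μ = fun _ => 0 := funext fun b => le_antisymm (hcon b) (h0 b)
    rw [this] at h1
    exact zero_ne_one (hasSum_zero.unique h1)
  induction a using Quotient.inductionOn' with
  | _ y =>
  induction b using Quotient.inductionOn' with
  | _ x =>
  have hreach := hirr x y
  induction hreach with
  | refl => exact hb
  | @tail z w _ hzw ih =>
    have hpos : 0 < factorMatrix Φ K hΦ (Quotient.mk'' z) (Quotient.mk'' w) := by
      refine lt_of_lt_of_le hzw ?_
      have hmem : w ∈ MulAction.orbitRel.Quotient.orbit (Quotient.mk'' w : Orbits Φ) :=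
        MulAction.orbitRel.Quotient.mem_orbit.2 rfl
      exact ((hK.2 z).summable.subtype (MulAction.orbitRel.Quotient.orbit
        (Quotient.mk'' w : Orbits Φ))).le_tsum ⟨w, hmem⟩ fun v _ => hK.1 z v.1
    refine lt_of_lt_of_le (mul_pos ih hpos) (le_hasSum (h2 _) (Quotient.mk'' z) fun c _ => ?_)
    exact mul_nonneg (h0 c) (factorMatrix_nonneg hK hΦ c _)

include hK in
/-- Bounded superharmonic functions which are constant on orbits are harmonic if the factor chain
has an invariant probability measure. -/
theorem harmonic_of_superharmonic (hirr : IsIrreducible K) {μ : Orbits Φ → ℝ}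
    (hμ : IsInvariantProbability (factorMatrix Φ K hΦ) μ) {f : V → ℝ≥0∞}
    (hf : ∀ φ ∈ Φ, ∀ x, f (φ x) = f x) (hf1 : ∀ x, f x ≤ 1)
    (hsup : ∀ x, ∑' y, ENNReal.ofReal (K x y) * f y ≤ f x) (x : V) :
    ∑' y, ENNReal.ofReal (K x y) * f y = f x := by
  let F : Orbits Φ → ℝ≥0∞ := fun a => Quotient.liftOn' a f (by
    rintro y z ⟨g, rfl⟩
    exact hf g g.2 z)
  have hF : ∀ x, F (Quotient.mk'' x) = f x := fun x => rfl
  let G : Orbits Φ → ℝ≥0∞ := fun a => ∑' b, ENNReal.ofReal (factorMatrix Φ K hΦ a b) * F b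
  have hG : ∀ x, G (Quotient.mk'' x) = ∑' y, ENNReal.ofReal (K x y) * f y := fun x =>
    (tsum_mul_lift hK hΦ F x).symm
  have hGF : ∀ a, G a ≤ F a := by
    intro a
    induction a using Quotient.inductionOn' with
    | _ x => rw [hG, hF]; exact hsup x
  have hF1 : ∀ a, F a ≤ 1 := by
    intro a
    induction a using Quotient.inductionOn' with
    | _ x => exact hf1 x
  have hinv : ∀ b, ∑' a, ENNReal.ofReal (μ a) * ENNReal.ofReal (factorMatrix Φ K hΦ a b) =
      ENNReal.ofReal (μ b) := by
    intro b
    rw [← (hμ.2.2 b).tsum_eq, ENNReal.ofReal_tsum_of_nonneg _ (hμ.2.2 b).summable]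
    · exact tsum_congr fun a => (ENNReal.ofReal_mul (hμ.1 a)).symm
    · exact fun a => mul_nonneg (hμ.1 a) (factorMatrix_nonneg hK hΦ a b)
  -- By invariance `G` and `F` have the same finite `μ`-integral. Since `G ≤ F` and every orbit has
  -- positive mass, strict inequality is impossible anywhere.
  have hint : ∑' a, ENNReal.ofReal (μ a) * G a = ∑' b, ENNReal.ofReal (μ b) * F b := by
    simp only [G]
    simp_rw [← ENNReal.tsum_mul_left]
    rw [ENNReal.tsum_comm]
    refine tsum_congr fun b => ?_
    rw [← hinv b, ← ENNReal.tsum_mul_right]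
    exact tsum_congr fun a => by ring
  have hfin : ∑' a, ENNReal.ofReal (μ a) * G a ≠ ⊤ := by
    rw [hint]
    refine ne_top_of_le_ne_top ENNReal.one_ne_top ?_
    calc ∑' b, ENNReal.ofReal (μ b) * F b ≤ ∑' b, ENNReal.ofReal (μ b) :=
          ENNReal.tsum_le_tsum fun b => mul_le_of_le_one_right' (hF1 b)
      _ = 1 := by
          rw [← ENNReal.ofReal_tsum_of_nonneg hμ.1 hμ.2.1.summable, hμ.2.1.tsum_eq,
            ENNReal.ofReal_one]
  rw [← hG, ← hF]
  refine le_antisymm (hGF _) (not_lt.1 fun hlt => ?_)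
  have hpos : ENNReal.ofReal (μ (Quotient.mk'' x)) ≠ 0 := by
    simpa using invariantProbability_pos hK hΦ hirr hμ (Quotient.mk'' x)
  have := ENNReal.tsum_lt_tsum (i := (Quotient.mk'' x : Orbits Φ)) hfin
    (fun a => mul_le_mul_right (hGF a) (ENNReal.ofReal (μ a)))
    ((ENNReal.mul_lt_mul_iff_right hpos ENNReal.ofReal_ne_top).2 hlt)
  exact this.ne hint

include hK in
/-- The maximum principle. -/
theorem eq_one_of_harmonic (hirr : IsIrreducible K) {f : V → ℝ≥0∞} (hf1 : ∀ x, f x ≤ 1)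
    (hharm : ∀ x, ∑' y, ENNReal.ofReal (K x y) * f y = f x) {x : V} (hx : f x = 1) (y : V) :
    f y = 1 := by
  have hreach := hirr x y
  induction hreach with
  | refl => exact hx
  | @tail z w _ hzw ih =>
    refine le_antisymm (hf1 w) (not_lt.1 fun hlt => ?_)
    have h1 : ∑' y, ENNReal.ofReal (K z y) * f y = 1 := (hharm z).trans ih
    have hlt' : ENNReal.ofReal (K z w) * f w < ENNReal.ofReal (K z w) := by
      conv_rhs => rw [← mul_one (ENNReal.ofReal (K z w))]
      exact (ENNReal.mul_lt_mul_iff_right (by simpa using hzw) ENNReal.ofReal_ne_top).2 hlt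
    have := ENNReal.tsum_lt_tsum (i := w) (f := fun y => ENNReal.ofReal (K z y) * f y)
      (g := fun y => ENNReal.ofReal (K z y)) (by rw [h1]; simp)
      (fun y => mul_le_of_le_one_right' (hf1 y)) hlt'
    rw [h1, tsum_ofReal_eq_one hK] at this
    exact lt_irrefl _ this

include hK in
theorem sum_factorMatrix [Fintype (Orbits Φ)] (a : Orbits Φ) :
    ∑ b, factorMatrix Φ K hΦ a b = 1 := by
  induction a using Quotient.inductionOn' with
  | _ x =>
  have h := tsum_mul_lift hK hΦ (fun _ => 1) x
  simp only [mul_one] at h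
  rw [tsum_ofReal_eq_one hK, tsum_fintype,
    ← ENNReal.ofReal_sum_of_nonneg fun b _ => factorMatrix_nonneg hK hΦ _ b] at h
  exact (ENNReal.ofReal_eq_one.1 h.symm)

/-- A stochastic matrix on a finite non-empty set has an invariant probability measure. -/
theorem exists_invariantProbability_of_fintype {A : Type*} [Fintype A] [Nonempty A]
    {M : A → A → ℝ} (hM : ∀ a b, 0 ≤ M a b) (hM1 : ∀ a, ∑ b, M a b = 1) :
    ∃ μ, IsInvariantProbability M μ := by
  classical
  -- `M - 1` annihilates the constants, so it is singular and also has a left null vector `v`.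
  have hdet : (Matrix.of M - 1).det = 0 := by
    rw [← Matrix.exists_mulVec_eq_zero_iff]
    refine ⟨fun _ => 1, fun h => one_ne_zero (congrFun h (Classical.arbitrary A)), ?_⟩
    rw [Matrix.sub_mulVec, Matrix.one_mulVec]
    ext a
    simp [Matrix.mulVec, dotProduct, hM1]
  obtain ⟨v, hv0, hv⟩ := Matrix.exists_vecMul_eq_zero_iff.2 hdet
  have hv' : ∀ b, ∑ a, v a * M a b = v b := by
    intro b
    have := congrFun hv b
    rw [Matrix.vecMul_sub, Matrix.vecMul_one, Pi.sub_apply, Pi.zero_apply, sub_eq_zero] at this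
    simpa [Matrix.vecMul, dotProduct] using this
  -- `v` may change sign. But `|v| ≤ |v| M` entrywise with equal totals, as rows sum to one, so
  -- `|v|` is invariant too and can be normalized.
  have hle : ∀ b, |v b| ≤ ∑ a, |v a| * M a b := by
    intro b
    conv_lhs => rw [← hv' b]
    refine (Finset.abs_sum_le_sum_abs _ _).trans (Finset.sum_le_sum fun a _ => ?_)
    rw [abs_mul, abs_of_nonneg (hM a b)]
  have hsum : ∑ b, |v b| = ∑ b, ∑ a, |v a| * M a b := by
    rw [Finset.sum_comm]
    simp_rw [← Finset.mul_sum, hM1, mul_one]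
  have heq : ∀ b, |v b| = ∑ a, |v a| * M a b := fun b =>
    (Finset.sum_eq_sum_iff_of_le fun b _ => hle b).1 hsum b (Finset.mem_univ b)
  have hpos : 0 < ∑ b, |v b| := by
    obtain ⟨a, ha⟩ := Function.ne_iff.1 hv0
    exact Finset.sum_pos' (fun b _ => abs_nonneg _) ⟨a, Finset.mem_univ a, abs_pos.2 ha⟩
  refine ⟨fun a => |v a| / ∑ b, |v b|, fun a => by positivity, ?_, fun b => ?_⟩
  · have := hasSum_fintype fun a => |v a| / ∑ b, |v b|
    rwa [← Finset.sum_div, div_self hpos.ne'] at this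
  · have := hasSum_fintype fun a => |v a| / (∑ b, |v b|) * M a b
    simp_rw [div_mul_eq_mul_div] at this ⊢
    rwa [← Finset.sum_div, ← heq b] at this

include hK in
theorem exists_invariantProbability_factorMatrix [Nonempty V] [Finite (Orbits Φ)] :
    ∃ μ, IsInvariantProbability (factorMatrix Φ K hΦ) μ := by
  have := Fintype.ofFinite (Orbits Φ)
  have : Nonempty (Orbits Φ) := ⟨Quotient.mk'' (Classical.arbitrary V)⟩
  exact exists_invariantProbability_of_fintype (factorMatrix_nonneg hK hΦ)
    (sum_factorMatrix hK hΦ)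

end FactorChain

/-! ### The action of vertex permutations on configurations -/

section Relabel

variable {V : Type*}

/-- The image of the entry of a site under a permutation of the vertices. -/
def relabelEntry (φ : Equiv.Perm V) (z : ℕ × (ℕ → V)) : ℕ × (ℕ → V) := (z.1, fun j => φ (z.2 j))

/-- The image of a configuration under a permutation of the vertices. -/
def relabel (φ : Equiv.Perm V) (ω : V → Site V) : V → Site V :=
  fun x i => relabelEntry φ (ω (φ.symm x) i)

theorem sends_relabel (φ : Equiv.Perm V) (ω : V → Site V) (x y : V) :
    Sends (relabel φ ω (φ x)) (φ y) ↔ Sends (ω x) y := by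
  simp [Sends, relabel, relabelEntry]

theorem mem_woken_relabel (φ : Equiv.Perm V) (ω : V → Site V) (v x : V) :
    φ x ∈ woken (relabel φ ω) (φ v) ↔ x ∈ woken ω v := by
  constructor
  · intro h
    have key : ∀ z, z ∈ woken (relabel φ ω) (φ v) → φ.symm z ∈ woken ω v := by
      intro z hz
      induction hz with
      | refl =>
        rw [Equiv.symm_apply_apply]
        exact self_mem_woken _ _
      | @tail b c _ hs ih =>
        refine woken_tail ih ?_
        rw [← sends_relabel φ]
        simpa using hs
    simpa using key _ h
  · intro h
    induction h with
    | refl => exact self_mem_woken _ _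
    | tail _ hs ih => exact woken_tail ih ((sends_relabel φ ω _ _).2 hs)

theorem visitedInf_relabel (φ : Equiv.Perm V) (ω : V → Site V) (v w : V) :
    VisitedInf (relabel φ ω) (φ v) (φ w) ↔ VisitedInf ω v w := by
  have : {x ∈ woken (relabel φ ω) (φ v) | Sends (relabel φ ω x) (φ w)} =
      φ '' {x ∈ woken ω v | Sends (ω x) w} := by
    ext z
    obtain ⟨x, rfl⟩ := φ.surjective z
    simp [mem_woken_relabel, sends_relabel]
  rw [VisitedInf, this, Set.infinite_image_iff φ.injective.injOn]
  rfl

variable [MeasurableSpace V]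

theorem measurable_relabelEntry [Countable V] [DiscreteMeasurableSpace V] (φ : Equiv.Perm V) :
    Measurable (relabelEntry φ) := by
  refine measurable_fst.prodMk (measurable_pi_iff.2 fun j => ?_)
  have h1 : Measurable φ := Measurable.of_discrete
  exact h1.comp ((measurable_pi_apply j).comp measurable_snd)

/-- Relabelling permutes the sites and then maps every entry; both operations send product measures
to product measures, and `hm` matches the factors. -/
theorem measurePreserving_relabel [Countable V] [DiscreteMeasurableSpace V]
    {m : V → ℕ → Measure (ℕ × (ℕ → V))} [∀ x i, IsProbabilityMeasure (m x i)]
    (φ : Equiv.Perm V) (hm : ∀ x i, (m x i).map (relabelEntry φ) = m (φ x) i) :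
    MeasurePreserving (relabel φ) (Measure.infinitePi fun x => Measure.infinitePi (m x))
      (Measure.infinitePi fun x => Measure.infinitePi (m x)) := by
  have h1 : Measurable fun (ω : V → Site V) x => ω (φ.symm x) := by fun_prop
  have hr : Measurable fun (a : Site V) i => relabelEntry φ (a i) :=
    measurable_pi_iff.2 fun i => (measurable_relabelEntry φ).comp (measurable_pi_apply i)
  have h2 : Measurable fun (ω : V → Site V) x => (fun i => relabelEntry φ (ω x i) : Site V) :=
    measurable_pi_iff.2 fun x => hr.comp (measurable_pi_apply x)
  have hcomp : relabel φ = (fun (ω : V → Site V) x => (fun i => relabelEntry φ (ω x i) : Site V)) ∘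
      fun (ω : V → Site V) x => ω (φ.symm x) := rfl
  refine ⟨hcomp ▸ h2.comp h1, ?_⟩
  rw [hcomp, ← Measure.map_map h2 h1,
    Measure.map_infinitePi_infinitePi_of_inj φ.symm.injective,
    Measure.infinitePi_map_pi _ (f := fun _ (a : Site V) i => relabelEntry φ (a i)) fun _ => hr]
  congr 1
  funext x
  rw [Measure.infinitePi_map_pi _ fun _ => measurable_relabelEntry φ]
  congr 1
  funext i
  rw [hm, Equiv.apply_symm_apply]

end Relabel

/-! ### The zero-one law for the product configuration -/

section Canonical

open scoped ENNReal

variable {V : Type*} [Countable V] [MeasurableSpace V] [DiscreteMeasurableSpace V]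
  {K : V → V → ℝ} {Φ : Subgroup (Equiv.Perm V)} {m : V → ℕ → Measure (ℕ × (ℕ → V))}
  [∀ x i, IsProbabilityMeasure (m x i)]

/-- The law of the configuration whose independent entries have the laws `m x i`. -/
noncomputable abbrev configLaw (m : V → ℕ → Measure (ℕ × (ℕ → V))) : Measure (V → Site V) :=
  Measure.infinitePi fun x => Measure.infinitePi (m x)

theorem ae_visitedInf_of_visitedInf (hK : IsStochastic K) (hirr : IsIrreducible K)
    (hm : ∀ x i, IsPathLaw K x ((m x (i + 1)).map Prod.snd)) :
    ∀ᵐ ω ∂(configLaw m), ∀ v w y, VisitedInf ω v w → VisitedInf ω v y := by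
  have hstep : ∀ᵐ ω ∂(configLaw m), ∀ v w y, 0 < K w y → VisitedInf ω v w →
      VisitedInf ω v y := by
    rw [ae_all_iff]
    intro v
    rw [ae_all_iff]
    intro w
    rw [ae_all_iff]
    intro y
    by_cases hwy : 0 < K w y
    · have hK1 : K w y ≤ 1 := le_hasSum (hK.2 w) y fun z _ => hK.1 w z
      have := ae_infinite_of_infinite (fun x => Measure.infinitePi (m x))
        (A := fun ω => woken ω v) (measurableSet_mem_woken v)
        (fun ω ω' h => woken_eq_of_eqOn h) (p := ENNReal.ofReal (K w y)) (by simpa using hwy)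
        (ENNReal.ofReal_le_one.2 hK1) (measurableSet_sends w) (measurableSet_firstVisitStep w y)
        (firstVisitStep_subset w y) fun x => measure_firstVisitStep (m x) (hm x) w y
      filter_upwards [this] with ω hω _ hv
      exact (hω hv).mono fun x hx => ⟨hx.1, sends_of_mem_firstVisitStep hx.2⟩
    · exact Filter.Eventually.of_forall fun ω h => absurd h hwy
  filter_upwards [hstep] with ω hω v w y hv
  have hreach := hirr w y
  induction hreach with
  | refl => exact hv
  | tail _ hzw ih => exact hω v _ _ hzw ih

theorem measurableSet_exists_visitedInf :
    MeasurableSet {ω : V → Site V | ∃ x, VisitedInf ω x x} := by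
  have : {ω : V → Site V | ∃ x, VisitedInf ω x x} = ⋃ x, {ω | VisitedInf ω x x} := by
    ext ω
    simp
  rw [this]
  exact MeasurableSet.iUnion fun x => measurableSet_visitedInf x x

theorem exists_visitedInf_zero_one (horb : ∀ x : V, (MulAction.orbit Φ x).Infinite)
    (hmΦ : ∀ φ ∈ Φ, ∀ x i, (m x i).map (relabelEntry φ) = m (φ x) i) :
    configLaw m {ω | ∃ x, VisitedInf ω x x} = 0 ∨
      configLaw m {ω | ∃ x, VisitedInf ω x x} = 1 := by
  classical
  refine measure_eq_zero_or_one_of_invariant _ measurableSet_exists_visitedInf fun E => ?_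
  obtain ⟨g, hg, hgE⟩ := exists_translate_disjoint Φ horb E
  refine ⟨relabel g, measurePreserving_relabel g (hmΦ g hg), ?_, ?_⟩
  · ext ω
    simp only [Set.mem_preimage, Set.mem_ofPred_eq]
    constructor
    · rintro ⟨x, hx⟩
      refine ⟨g.symm x, ?_⟩
      rw [← visitedInf_relabel g]
      simpa using hx
    · rintro ⟨x, hx⟩
      exact ⟨g x, (visitedInf_relabel g ω x x).2 hx⟩
  · have hind : iIndepFun (fun x (ω : V → Site V) => ω x) (configLaw m) :=
      iIndepFun_infinitePi (X := fun _ (a : Site V) => a) (fun _ => measurable_id)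
    -- The relabelled configuration on `E` is a function of the original one on the preimage of `E`
    -- under `g`, which is disjoint from `E`.
    have hdisj : Disjoint E (E.image g.symm) := by
      rw [Finset.disjoint_left]
      intro x hx hx'
      obtain ⟨y, hy, rfl⟩ := Finset.mem_image.1 hx'
      exact hgE _ hx (by simpa using hy)
    have h := hind.indepFun_finset E (E.image g.symm) hdisj fun x => measurable_pi_apply x
    have hmem : ∀ x : E, g.symm x ∈ E.image g.symm := fun x => Finset.mem_image_of_mem _ x.2
    have hψ : Measurable fun (b : ↥(E.image g.symm) → Site V) (x : E) =>
        (fun i => relabelEntry g (b ⟨g.symm x, hmem x⟩ i) : Site V) := by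
      refine measurable_pi_iff.2 fun x => measurable_pi_iff.2 fun i => ?_
      exact (measurable_relabelEntry g).comp
        ((measurable_pi_apply i).comp (measurable_pi_apply _))
    exact h.comp measurable_id hψ

/-- The probability that a path with law `ν` visits a vertex `y` which is recurrent in the
configuration `ω`. -/
noncomputable def hitProb (ν : Measure (ℕ → V)) (ω : V → Site V) : ℝ≥0∞ :=
  ν {s | ∃ j, s j ∈ {y | VisitedInf ω y y}}

theorem measurableSet_hit : MeasurableSet
    {q : (V → Site V) × (ℕ → V) | ∃ j, q.2 j ∈ {y | VisitedInf q.1 y y}} := by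
  have : {q : (V → Site V) × (ℕ → V) | ∃ j, q.2 j ∈ {y | VisitedInf q.1 y y}} =
      ⋃ j : ℕ, ⋃ y : V, {ω | VisitedInf ω y y} ×ˢ {s | s j = y} := by
    ext q
    simp
  rw [this]
  exact MeasurableSet.iUnion fun j => MeasurableSet.iUnion fun y =>
    (measurableSet_visitedInf y y).prod (measurableSet_coord_eq j y)

theorem measurable_hitProb (ν : Measure (ℕ → V)) [SFinite ν] : Measurable (hitProb ν) :=
  measurable_measure_prodMk_left measurableSet_hit

omit [Countable V] in
theorem hitProb_relabel (ν : Measure (ℕ → V)) (φ : Equiv.Perm V) (ω : V → Site V) :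
    hitProb (ν.map fun s j => φ (s j)) (relabel φ ω) = hitProb ν ω := by
  have hφ : Measurable fun (s : ℕ → V) j => φ (s j) := by
    refine measurable_pi_iff.2 fun j => ?_
    exact (Measurable.of_discrete (f := φ)).comp (measurable_pi_apply j)
  rw [hitProb, hitProb, Measure.map_apply hφ (measurableSet_hits _)]
  congr 1
  ext s
  simp [visitedInf_relabel]

/-- If some vertex is recurrent, then every Markov chain independent of the configuration visits
recurrent vertices. -/
theorem ae_hitProb_eq_one (hK : IsStochastic K) (hirr : IsIrreducible K)
    (hΦ : IsInvariantUnder Φ K) {μ : Orbits Φ → ℝ}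
    (hμ : IsInvariantProbability (factorMatrix Φ K hΦ) μ)
    (hmΦ : ∀ φ ∈ Φ, ∀ x i, (m x i).map (relabelEntry φ) = m (φ x) i)
    {ν : V → Measure (ℕ → V)} (hν : ∀ x, IsPathLaw K x (ν x)) :
    ∀ᵐ ω ∂(configLaw m), (∃ x, VisitedInf ω x x) → ∀ x, hitProb (ν x) ω = 1 := by
  have hprob := fun x => (hν x).isProbabilityMeasure
  have hle1 : ∀ x ω, hitProb (ν x) ω ≤ 1 := fun x ω => prob_le_one
  have hmeas : ∀ x, Measurable (hitProb (ν x)) := fun x => measurable_hitProb (ν x)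
  have hsup : ∀ x ω, ∑' y, ENNReal.ofReal (K x y) * hitProb (ν y) ω ≤ hitProb (ν x) ω :=
    fun x ω => IsPathLaw.sum_hits_le hK hν _ x
  have hsm : ∀ x, Measurable fun ω => ∑' y, ENNReal.ofReal (K x y) * hitProb (ν y) ω :=
    fun x => Measurable.tsum fun y => (hmeas y).const_mul _
  -- For fixed `ω` the hitting probability need not be constant on orbits; its mean is, because the
  -- law of the configuration is invariant.
  let f : V → ℝ≥0∞ := fun x => ∫⁻ ω, hitProb (ν x) ω ∂(configLaw m)
  have hfΦ : ∀ φ ∈ Φ, ∀ x, f (φ x) = f x := by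
    intro φ hφ x
    have hmap : ν (φ x) = (ν x).map fun s j => φ (s j) :=
      (hν (φ x)).unique ((hν x).map_perm φ (hΦ φ hφ))
    simp only [f]
    rw [← (measurePreserving_relabel φ (hmΦ φ hφ)).lintegral_comp (hmeas (φ x)), hmap]
    exact lintegral_congr fun ω => hitProb_relabel (ν x) φ ω
  have hf1 : ∀ x, f x ≤ 1 := by
    intro x
    calc f x ≤ ∫⁻ _, 1 ∂(configLaw m) := lintegral_mono (hle1 x)
      _ = 1 := by simp
  have hfK : ∀ x, ∑' y, ENNReal.ofReal (K x y) * f y =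
      ∫⁻ ω, ∑' y, ENNReal.ofReal (K x y) * hitProb (ν y) ω ∂(configLaw m) := by
    intro x
    rw [lintegral_tsum fun y => ((hmeas y).const_mul _).aemeasurable]
    exact tsum_congr fun y => (lintegral_const_mul _ (hmeas y)).symm
  have hfsup : ∀ x, ∑' y, ENNReal.ofReal (K x y) * f y ≤ f x := by
    intro x
    rw [hfK]
    exact lintegral_mono (hsup x)
  have hharm : ∀ᵐ ω ∂(configLaw m), ∀ x,
      ∑' y, ENNReal.ofReal (K x y) * hitProb (ν y) ω = hitProb (ν x) ω := by
    rw [ae_all_iff]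
    intro x
    -- Harmonicity of the mean turns the pointwise inequality `hsup` into an almost sure equality.
    have heq := (harmonic_of_superharmonic hK hΦ hirr hμ hfΦ hf1 hfsup x).symm
    refine ae_eq_of_ae_le_of_lintegral_le (Filter.Eventually.of_forall (hsup x)) ?_
      (hmeas x).aemeasurable ?_
    · rw [← hfK]
      exact ne_top_of_le_ne_top ENNReal.one_ne_top ((hfsup x).trans (hf1 x))
    · rw [← hfK]
      exact heq.le
  filter_upwards [hharm] with ω hω hex x
  obtain ⟨z, hz⟩ := hex
  exact eq_one_of_harmonic hK hirr (fun y => hle1 y ω) hω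
    ((hν z).hits_eq_one (D := {y | VisitedInf ω y y}) hz) x

theorem ae_visitedInf_of_count_pos (hK : IsStochastic K) (hirr : IsIrreducible K)
    (hΦ : IsInvariantUnder Φ K) (horb : ∀ x : V, (MulAction.orbit Φ x).Infinite)
    {μ : Orbits Φ → ℝ} (hμ : IsInvariantProbability (factorMatrix Φ K hΦ) μ)
    (hm : ∀ x i, IsPathLaw K x ((m x (i + 1)).map Prod.snd))
    (hmΦ : ∀ φ ∈ Φ, ∀ x i, (m x i).map (relabelEntry φ) = m (φ x) i)
    {v : V} (hv : configLaw m {ω | VisitedInf ω v v} ≠ 0) (u : V) :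
    ∀ᵐ ω ∂(configLaw m), 1 ≤ (ω u 0).1 → VisitedInf ω u u := by
  classical
  let ν : V → Measure (ℕ → V) := fun x => (m x 1).map Prod.snd
  have hν : ∀ x, IsPathLaw K x (ν x) := fun x => hm x 0
  have hprob := fun x => (hν x).isProbabilityMeasure
  have hT : ∀ᵐ ω ∂(configLaw m), ∃ x, VisitedInf ω x x := by
    have hsub : {ω : V → Site V | VisitedInf ω v v} ⊆ {ω | ∃ x, VisitedInf ω x x} :=
      fun ω hω => ⟨v, hω⟩
    have h1 := (exists_visitedInf_zero_one horb hmΦ).resolve_left fun h0 =>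
      hv (measure_mono_null hsub h0)
    exact (mem_ae_iff_prob_eq_one measurableSet_exists_visitedInf).2 h1
  -- A site without frogs; its paths are immaterial.
  let a : Site V := fun _ => (0, fun _ => u)
  have ha : (a 0).1 = 0 := rfl
  have hupd : Measurable fun ω : V → Site V => Function.update ω u a := by
    refine measurable_pi_iff.2 fun x => ?_
    by_cases hx : x = u
    · subst hx
      simp only [Function.update_self]
      exact measurable_const
    · simp only [Function.update_of_ne hx]
      exact measurable_pi_apply x
  have hpath : Measurable fun b : Site V => (b 1).2 := by fun_prop
  have hpathu : Measurable fun ω : V → Site V => (ω u 1).2 := hpath.comp (measurable_pi_apply u)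
  have hlaw : (configLaw m).map (fun ω => (ω u 1).2) = ν u := by
    have h1 : (fun ω : V → Site V => (ω u 1).2) =
        Prod.snd ∘ (fun b : Site V => b 1) ∘ fun ω : V → Site V => ω u := rfl
    rw [h1, ← Measure.map_map measurable_snd ((measurable_pi_apply 1).comp (measurable_pi_apply u)),
      ← Measure.map_map (measurable_pi_apply 1) (measurable_pi_apply u),
      Measure.infinitePi_map_eval, Measure.infinitePi_map_eval]
  have hhit : ∀ᵐ ω ∂(configLaw m), hitProb (ν u) (Function.update ω u a) = 1 →
      ∃ j, (ω u 1).2 j ∈ {y | VisitedInf (Function.update ω u a) y y} := by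
    -- The exceptional pairs: a hitting probability of one, yet a path that misses. Since the
    -- emptied configuration is independent of the first path at `u`, Fubini shows that such pairs
    -- have probability zero.
    let B : Set ((V → Site V) × (ℕ → V)) :=
      {q | hitProb (ν u) q.1 = 1} \ {q | ∃ j, q.2 j ∈ {y | VisitedInf q.1 y y}}
    have hB : MeasurableSet B := MeasurableSet.diff
      (((measurable_hitProb (ν u)).comp measurable_fst) (measurableSet_singleton 1))
      measurableSet_hit
    have hind : IndepFun (fun ω : V → Site V => Function.update ω u a)
        (fun ω => (ω u 1).2) (configLaw m) :=
      (indepFun_eval_update (fun x => Measure.infinitePi (m x)) u a).symm.comp measurable_id hpath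
    have hprod := (indepFun_iff_map_prod_eq_prod_map_map hupd.aemeasurable
      hpathu.aemeasurable).1 hind
    rw [hlaw] at hprod
    have hnull : ((configLaw m).map fun ω => (Function.update ω u a, (ω u 1).2)) B = 0 := by
      rw [hprod, Measure.measure_prod_null hB]
      refine Filter.Eventually.of_forall fun ω => ?_
      by_cases hω : hitProb (ν u) ω = 1
      · have h1 : Prod.mk ω ⁻¹' B = {s | ∃ j, s j ∈ {y | VisitedInf ω y y}}ᶜ := by
          ext s
          simp [B, hω]
        change ν u (Prod.mk ω ⁻¹' B) = 0
        rw [h1, prob_compl_eq_zero_iff (measurableSet_hits _)]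
        exact hω
      · have h1 : Prod.mk ω ⁻¹' B = ∅ := by
          ext s
          simp [B, hω]
        change ν u (Prod.mk ω ⁻¹' B) = 0
        rw [h1, measure_empty]
    rw [Measure.map_apply (hupd.prodMk hpathu) hB] at hnull
    filter_upwards [measure_eq_zero_iff_ae_notMem.1 hnull] with ω hω h1
    by_contra h2
    exact hω ⟨h1, h2⟩
  filter_upwards [hT, ae_hitProb_eq_one hK hirr hΦ hμ hmΦ hν,
    ae_visitedInf_of_visitedInf hK hirr hm, hhit] with ω hex h1 hall hhit hcount
  by_contra hu
  -- If emptying `u` destroyed the recurrence of `y`, then `y` would be visited infinitely often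
  -- starting from `u`, and hence so would `u`.
  have hsub : {y | VisitedInf ω y y} ⊆ {y | VisitedInf (Function.update ω u a) y y} := by
    intro y hy
    rcases VisitedInf.update_or (u := u) (a := a) hy with h | h
    · exact h
    · exact absurd (hall u y u h) hu
  have hone : hitProb (ν u) (Function.update ω u a) = 1 := by
    refine le_antisymm prob_le_one ?_
    rw [← h1 hex u]
    exact measure_mono fun s ⟨j, hj⟩ => ⟨j, hsub hj⟩
  obtain ⟨j, hj⟩ := hhit hone
  refine hu (hall u _ u (VisitedInf.of_mem_woken (x := (ω u 1).2 j) ?_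
    (VisitedInf.of_update ha hj)))
  exact woken_tail (self_mem_woken ω u) ⟨0, hcount, j, rfl⟩

end Canonical

/-! ### From the given probability space to the product configuration -/

section Transfer

variable {V Ω : Type*} [Countable V] [MeasurableSpace V] [DiscreteMeasurableSpace V]
  [MeasurableSpace Ω]

/-- The entries of the random configuration built from `η` and `S`. -/
def entry (η : V → Ω → ℕ) (S : V → ℕ → ℕ → Ω → V) (x : V) (i : ℕ) (ω : Ω) : ℕ × (ℕ → V) :=
  Nat.casesOn i (η x ω, fun _ => x) fun i => (0, fun j => S x i j ω)

variable {η : V → Ω → ℕ} {S : V → ℕ → ℕ → Ω → V}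

omit [Countable V] [DiscreteMeasurableSpace V] in
theorem measurable_entry (hη : ∀ x, Measurable (η x)) (hS : ∀ x i j, Measurable (S x i j)) (x : V)
    (i : ℕ) : Measurable (entry η S x i) := by
  cases i with
  | zero => exact (hη x).prodMk measurable_const
  | succ i => exact measurable_const.prodMk (measurable_pi_iff.2 fun j => hS x i j)

omit [Countable V] [DiscreteMeasurableSpace V] in
theorem map_entry_eq_configLaw {P : Measure Ω} [IsProbabilityMeasure P]
    (hη : ∀ x, Measurable (η x)) (hS : ∀ x i j, Measurable (S x i j))
    (hind : IndependentIngredients P η S) :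
    P.map (fun ω x i => entry η S x i ω) = configLaw fun x i => P.map (entry η S x i) := by
  have hm := measurable_entry hη hS
  have _ : ∀ x i, IsProbabilityMeasure (P.map (entry η S x i)) := fun x i =>
    Measure.isProbabilityMeasure_map (hm x i).aemeasurable
  -- Entry `0` of `x` is driven by `η x`, entry `i + 1` by the path with index `i`. The flat product
  -- law over `V × ℕ` is then curried into a product over sites.
  let e : V × ℕ → V ⊕ (V × ℕ) := fun q => Nat.casesOn q.2 (Sum.inl q.1) fun i => Sum.inr (q.1, i)
  have he : Function.Injective e := by
    rintro ⟨x, i⟩ ⟨y, j⟩ h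
    cases i <;> cases j <;> simp_all [e]
  have hfun : iIndepFun (fun (q : V × ℕ) ω => entry η S q.1 q.2 ω) P := by
    rw [iIndepFun_iff_iIndep]
    refine iIndep_of_iIndep_of_le (iIndep.precomp he hind) ?_
    rintro ⟨x, i⟩
    cases i with
    | zero =>
      have h1 : (fun ω => entry η S x 0 ω) = (fun n : ℕ => (n, fun _ : ℕ => x)) ∘ η x := rfl
      change MeasurableSpace.comap (fun ω => entry η S x 0 ω) _ ≤
        MeasurableSpace.comap (η x) inferInstance
      rw [h1, ← MeasurableSpace.comap_comp]
      exact MeasurableSpace.comap_mono (measurable_id.prodMk measurable_const).comap_le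
    | succ i =>
      have h1 : (fun ω => entry η S x (i + 1) ω) =
          (fun s : ℕ → V => ((0 : ℕ), s)) ∘ fun ω j => S x i j ω := rfl
      change MeasurableSpace.comap (fun ω => entry η S x (i + 1) ω) _ ≤
        MeasurableSpace.comap (fun ω j => S x i j ω) inferInstance
      rw [h1, ← MeasurableSpace.comap_comp]
      exact MeasurableSpace.comap_mono (measurable_const.prodMk measurable_id).comap_le
  have hflat := hfun.map_fun_eq_infinitePi_map fun (q : V × ℕ) => hm q.1 q.2
  have hcurry := Measure.infinitePi_map_curry fun x i => P.map (entry η S x i)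
  rw [← hflat, Measure.map_map (MeasurableEquiv.measurable _)
    (measurable_pi_iff.2 fun (q : V × ℕ) => hm q.1 q.2)] at hcurry
  exact hcurry

theorem zeroOneLaw_of_invariantProbability [Infinite V] {P : Measure Ω} [IsProbabilityMeasure P]
    {K : V → V → ℝ} (hK : IsStochastic K) (hirr : IsIrreducible K)
    {Φ : Subgroup (Equiv.Perm V)} (hΦ : IsInvariantUnder Φ K)
    (horb : ∀ x : V, (MulAction.orbit Φ x).Infinite)
    (hη : ∀ x, Measurable (η x)) (hS0 : ∀ x i ω, S x i 0 ω = x)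
    (hS : ∀ x i, IsMarkovChain P K (S x i))
    (hid : ∀ x, ∀ y ∈ MulAction.orbit Φ x, IdentDistrib (η x) (η y) P P)
    (hind : IndependentIngredients P η S)
    {μ : Orbits Φ → ℝ} (hμ : IsInvariantProbability (factorMatrix Φ K hΦ) μ) :
    ZeroOneLaw P (fun _ => K) η S := by
  have hSm : ∀ x i j, Measurable (S x i j) := fun x i => (hS x i).1
  have hem := measurable_entry hη hSm
  have hem' : Measurable fun ω x i => entry η S x i ω :=
    measurable_pi_iff.2 fun x => measurable_pi_iff.2 fun i => hem x i
  let m : V → ℕ → Measure (ℕ × (ℕ → V)) := fun x i => P.map (entry η S x i)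
  have _ : ∀ x i, IsProbabilityMeasure (m x i) := fun x i =>
    Measure.isProbabilityMeasure_map (hem x i).aemeasurable
  have hlaw : P.map (fun ω x i => entry η S x i ω) = configLaw m :=
    map_entry_eq_configLaw hη hSm hind
  have hpath : ∀ x i, IsPathLaw K x (P.map fun ω j => S x i j ω) := fun x i =>
    isPathLaw_map (hS x i) (hS0 x i)
  have hpm : ∀ x i, Measurable fun ω j => S x i j ω := fun x i =>
    measurable_pi_iff.2 fun j => hSm x i j
  have hm : ∀ x i, IsPathLaw K x ((m x (i + 1)).map Prod.snd) := by
    intro x i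
    rw [Measure.map_map measurable_snd (hem x (i + 1))]
    exact hpath x i
  have hmΦ : ∀ φ ∈ Φ, ∀ x i, (m x i).map (relabelEntry φ) = m (φ x) i := by
    intro φ hφ x i
    rw [Measure.map_map (measurable_relabelEntry φ) (hem x i)]
    cases i with
    | zero =>
      have h1 : Measurable fun n : ℕ => (n, fun _ : ℕ => φ x) :=
        measurable_id.prodMk measurable_const
      -- The dummy path in entry `0` is constantly `x`, so that relabelling carries it to the dummy
      -- path at `φ x`.
      have h2 : relabelEntry φ ∘ entry η S x 0 = (fun n : ℕ => (n, fun _ : ℕ => φ x)) ∘ η x := rfl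
      have h3 : entry η S (φ x) 0 = (fun n : ℕ => (n, fun _ : ℕ => φ x)) ∘ η (φ x) := rfl
      simp only [m]
      rw [h2, h3, ← Measure.map_map h1 (hη x), ← Measure.map_map h1 (hη (φ x)),
        (hid x (φ x) ⟨⟨φ, hφ⟩, rfl⟩).map_eq]
    | succ i =>
      have h1 : Measurable fun s : ℕ → V => ((0 : ℕ), s) := measurable_const.prodMk measurable_id
      have h4 : Measurable fun (s : ℕ → V) j => φ (s j) := by
        refine measurable_pi_iff.2 fun j => ?_
        exact (Measurable.of_discrete (f := φ)).comp (measurable_pi_apply j)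
      have h2 : relabelEntry φ ∘ entry η S x (i + 1) =
          (fun s : ℕ → V => ((0 : ℕ), s)) ∘ (fun (s : ℕ → V) j => φ (s j)) ∘
            fun ω j => S x i j ω := rfl
      have h3 : entry η S (φ x) (i + 1) =
          (fun s : ℕ → V => ((0 : ℕ), s)) ∘ fun ω j => S (φ x) i j ω := rfl
      simp only [m]
      rw [h2, h3, ← Measure.map_map h1 (h4.comp (hpm x i)), ← Measure.map_map h4 (hpm x i),
        ← Measure.map_map h1 (hpm (φ x) i)]
      congr 1
      exact ((hpath x i).map_perm φ (hΦ φ hφ)).unique (hpath (φ x) i)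
  have hrec : ∀ v, recurrenceEvent η S v =
      (fun ω x i => entry η S x i ω) ⁻¹' {c | VisitedInf c v v} := by
    intro v
    ext ω
    exact isRecurrentSite_iff (ω := fun x i => entry η S x i ω) (fun x i => hS0 x i ω) v
  have hPrec : ∀ v, P (recurrenceEvent η S v) = configLaw m {c | VisitedInf c v v} := by
    intro v
    rw [hrec, ← hlaw, Measure.map_apply hem' (measurableSet_visitedInf v v)]
  by_cases hall : ∀ v, P (recurrenceEvent η S v) = 0
  · exact Or.inl hall
  · right
    obtain ⟨v, hv⟩ := not_forall.1 hall
    rw [hPrec] at hv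
    intro u
    have hcl : (cluster K u).Infinite := by
      have : cluster K u = Set.univ := Set.eq_univ_of_forall fun y => ⟨hirr u y, hirr y u⟩
      rw [this]
      exact Set.infinite_univ
    have hae := ae_visitedInf_of_count_pos hK hirr hΦ horb hμ hm hmΦ hv u
    rw [← hlaw] at hae
    refine measure_congr ?_
    filter_upwards [ae_of_ae_map hem'.aemeasurable hae] with ω hω
    refine propext ?_
    change ω ∈ recurrenceEvent η S u ↔ (1 ≤ η u ω ∧ (cluster K u).Infinite)
    rw [hrec]
    exact ⟨fun h => ⟨VisitedInf.count_pos h, hcl⟩, fun h => hω h.1⟩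

end Transfer

end Frog

theorem theorem3 {V Ω : Type*} [Countable V] [Infinite V]
    [MeasurableSpace V] [DiscreteMeasurableSpace V]
    [MeasurableSpace Ω] (P : Measure Ω) [IsProbabilityMeasure P]
    (K : V → V → ℝ) (hK : Frog.IsStochastic K) (hirr : Frog.IsIrreducible K)
    (Φ : Subgroup (Equiv.Perm V)) (hΦ : Frog.IsInvariantUnder Φ K)
    (horb : ∀ x : V, (MulAction.orbit Φ x).Infinite)
    (η : V → Ω → ℕ) (S : V → ℕ → ℕ → Ω → V)
    (hη : ∀ x, Measurable (η x))
    (hS0 : ∀ x i ω, S x i 0 ω = x)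
    (hS : ∀ x i, Frog.IsMarkovChain P K (S x i))
    (hid : ∀ x, ∀ y ∈ MulAction.orbit Φ x, IdentDistrib (η x) (η y) P P)
    (hind : Frog.IndependentIngredients P η S) :
    ((∃ μ, Frog.IsInvariantProbability (Frog.factorMatrix Φ K hΦ) μ) →
      Frog.ZeroOneLaw P (fun _ => K) η S) ∧
    (Finite (Frog.Orbits Φ) →
      (∃ μ, Frog.IsInvariantProbability (Frog.factorMatrix Φ K hΦ) μ) ∧
      Frog.ZeroOneLaw P (fun _ => K) η S) := by
  have hlaw : (∃ μ, Frog.IsInvariantProbability (Frog.factorMatrix Φ K hΦ) μ) →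
      Frog.ZeroOneLaw P (fun _ => K) η S := fun ⟨_, hμ⟩ =>
    Frog.zeroOneLaw_of_invariantProbability hK hirr hΦ horb hη hS0 hS hid hind hμ
  refine ⟨hlaw, fun _ => ?_⟩
  have hex := Frog.exists_invariantProbability_factorMatrix hK hΦ
  exact ⟨hex, hlaw hex⟩
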